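/- Consider paths with at most one bend on the grid $\mathbb{N}\times\mathbb{N}$: such a path is the union of a horizontal segment and a vertical segment (either may be degenerate) sharing an end, its corner. A path with exactly one bend has one of the four shapes $\ulcorner,\urcorner,\llcorner,\lrcorner$. A family $(P_v)_{v\in V}$ of such paths represents the graph $G$ on $V$ in which two distinct vertices $u,v$ are adjacent if and only if $P_u$ and $P_v$ share a grid edge. Let $\mathrm{OPT}$ be the maximum size of an independent set of $G$. Consider instances consisting of an integer $k\ge 0$ and a family of $n$ such paths, given by their coordinates, whose bent paths all have their shape in some set $X$ of three of the four shapes. Running times are counted on a unit-cost random access machine with addition, (truncated) subtraction, comparison and indirect addressing on natural numbers. (1) There is an algorithm and a polynomial $p$ such that, on every such instance, the algorithm correctly decides whether $\mathrm{OPT}\ge k$ in time at most $k^{2k}\,p(n)$ (with $0^0=1$). (2) There is an algorithm and a polynomial $q$ such that, on every such instance with $k\ge 1$, the algorithm computes, in time at most $q(n)$, a set $X'$ of at most $17k^2$ vertices with the following property: if $G$ has an independent set of size $k$, then $G$ has an independent set of size $k$ that contains an element of $X'$. -/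

import Mathlib

namespace EPG

/-! ## Grid paths with at most one bend, and their edge intersection graphs -/

/-- A path with at most one bend on the grid `ℕ × ℕ`: the horizontal segment from the corner
`(cx, cy)` to `(hx, cy)` together with the vertical segment from `(cx, cy)` to `(cx, vy)`.
If `hx = cx` the path is purely vertical, if `vy = cy` it is purely horizontal, and then
its "corner" is one of its ends. -/
structure GridPath where
  /-- column of the corner -/
  cx : ℕ
  /-- row of the corner -/
  cy : ℕ
  /-- column of the end of the horizontal part -/
  hx : ℕ
  /-- row of the end of the vertical part -/
  vy : ℕ

/-- The four shapes of a path with exactly one bend, named after the position of the corner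
(first coordinate to the right, second coordinate upwards). -/
inductive Shape where
  | lowerLeft
  | upperLeft
  | upperRight
  | lowerRight
  deriving DecidableEq

/-- The path `P` has exactly one bend, and the given shape. Straight paths have no bend, so
they satisfy this for no shape. -/
def GridPath.HasShape (P : GridPath) : Shape → Prop
  | .lowerLeft => P.cx < P.hx ∧ P.cy < P.vy
  | .upperLeft => P.cx < P.hx ∧ P.vy < P.cy
  | .upperRight => P.hx < P.cx ∧ P.vy < P.cy
  | .lowerRight => P.hx < P.cx ∧ P.cy < P.vy

/-- The set of (unit) grid edges used by a path. -/
def GridPath.edges (P : GridPath) : Set (Sym2 (ℕ × ℕ)) :=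
  {e | ∃ i, min P.cx P.hx ≤ i ∧ i < max P.cx P.hx ∧ e = s((i, P.cy), (i + 1, P.cy))} ∪
  {e | ∃ j, min P.cy P.vy ≤ j ∧ j < max P.cy P.vy ∧ e = s((P.cx, j), (P.cx, j + 1))}

/-- The graph represented by a family of paths: two distinct vertices are adjacent iff their
paths share a grid edge. -/
def graph {V : Type*} (R : V → GridPath) : SimpleGraph V where
  Adj u v := u ≠ v ∧ ((R u).edges ∩ (R v).edges).Nonempty
  symm := ⟨fun _ _ h => ⟨h.1.symm, by rw [Set.inter_comm]; exact h.2⟩⟩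
  loopless := ⟨fun _ h => h.1 rfl⟩

/-- Every bent path of the family has its shape in `X`. -/
def UsesShapes {V : Type*} (X : Finset Shape) (R : V → GridPath) : Prop :=
  ∀ v s, (R v).HasShape s → s ∈ X

/-! ## A random access machine with unit costs

Structured programs over registers and arrays of natural numbers. A program mentions only
finitely many registers and arrays. Available operations: constants, addition, truncated
subtraction, indirect addressing, and comparison, each at cost one. -/

/-- A machine state: registers, and arrays (`arr a i` is entry `i` of array number `a`). -/
structure State where
  reg : ℕ → ℕ
  arr : ℕ → ℕ → ℕ

/-- Expressions. -/
inductive Expr where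
  | const (c : ℕ)
  | reg (x : ℕ)
  | add (e₁ e₂ : Expr)
  | sub (e₁ e₂ : Expr)
  | arr (a : ℕ) (e : Expr)

/-- The value of an expression. -/
def Expr.eval (σ : State) : Expr → ℕ
  | .const c => c
  | .reg x => σ.reg x
  | .add e₁ e₂ => e₁.eval σ + e₂.eval σ
  | .sub e₁ e₂ => e₁.eval σ - e₂.eval σ
  | .arr a e => σ.arr a (e.eval σ)

/-- The cost of evaluating an expression: one unit for each constant, register access,
arithmetic operation and array access in it. -/
def Expr.cost : Expr → ℕ
  | .const _ => 1
  | .reg _ => 1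
  | .add e₁ e₂ => e₁.cost + e₂.cost + 1
  | .sub e₁ e₂ => e₁.cost + e₂.cost + 1
  | .arr _ e => e.cost + 1

/-- Programs. Tests are comparisons `e₁ < e₂`. -/
inductive Program where
  | skip
  | assign (x : ℕ) (e : Expr)
  | store (a : ℕ) (i e : Expr)
  | seq (p q : Program)
  | ifLt (e₁ e₂ : Expr) (p q : Program)
  | whileLt (e₁ e₂ : Expr) (p : Program)

/-- The state after register `x` receives the value `v`. -/
def State.setReg (σ : State) (x v : ℕ) : State :=
  ⟨Function.update σ.reg x v, σ.arr⟩

/-- The state after entry `i` of array `a` receives the value `v`. -/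
def State.setArr (σ : State) (a i v : ℕ) : State :=
  ⟨σ.reg, Function.update σ.arr a (Function.update (σ.arr a) i v)⟩

/-- `Exec p σ t τ`: started in state `σ`, the program `p` halts after exactly `t` steps in
state `τ`. -/
inductive Exec : Program → State → ℕ → State → Prop where
  | skip (σ : State) : Exec .skip σ 1 σ
  | assign (σ : State) (x : ℕ) (e : Expr) :
      Exec (.assign x e) σ (e.cost + 1) (σ.setReg x (e.eval σ))
  | store (σ : State) (a : ℕ) (i e : Expr) :
      Exec (.store a i e) σ (i.cost + e.cost + 1) (σ.setArr a (i.eval σ) (e.eval σ))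
  | seq {p q : Program} {σ σ' τ : State} {s t : ℕ} :
      Exec p σ s σ' → Exec q σ' t τ → Exec (.seq p q) σ (s + t) τ
  | ifTrue {e₁ e₂ : Expr} {p q : Program} {σ τ : State} {t : ℕ} :
      e₁.eval σ < e₂.eval σ → Exec p σ t τ →
      Exec (.ifLt e₁ e₂ p q) σ (e₁.cost + e₂.cost + 1 + t) τ
  | ifFalse {e₁ e₂ : Expr} {p q : Program} {σ τ : State} {t : ℕ} :
      ¬ e₁.eval σ < e₂.eval σ → Exec q σ t τ →
      Exec (.ifLt e₁ e₂ p q) σ (e₁.cost + e₂.cost + 1 + t) τ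
  | whileTrue {e₁ e₂ : Expr} {p : Program} {σ σ' τ : State} {s t : ℕ} :
      e₁.eval σ < e₂.eval σ → Exec p σ s σ' → Exec (.whileLt e₁ e₂ p) σ' t τ →
      Exec (.whileLt e₁ e₂ p) σ (e₁.cost + e₂.cost + 1 + s + t) τ
  | whileFalse {e₁ e₂ : Expr} {p : Program} {σ : State} :
      ¬ e₁.eval σ < e₂.eval σ →
      Exec (.whileLt e₁ e₂ p) σ (e₁.cost + e₂.cost + 1) σ

/-! ## Input and output conventions -/

/-- The initial state on an instance: register 0 holds the number `n` of paths, register 1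
holds `k`, arrays 0, 1, 2, 3 hold the four coordinates of the paths; all else is zero. -/
def input {n : ℕ} (R : Fin n → GridPath) (k : ℕ) : State where
  reg x := if x = 0 then n else if x = 1 then k else 0
  arr a i :=
    if h : i < n then
      if a = 0 then (R ⟨i, h⟩).cx
      else if a = 1 then (R ⟨i, h⟩).cy
      else if a = 2 then (R ⟨i, h⟩).hx
      else if a = 3 then (R ⟨i, h⟩).vy
      else 0
    else 0

/-- A halting state answers "yes" if register 0 holds 1, and "no" if it holds 0. -/
def State.Answers (τ : State) (Q : Prop) : Prop :=
  (τ.reg 0 = 1 ∧ Q) ∨ (τ.reg 0 = 0 ∧ ¬ Q)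

/-- A halting state outputs the set `X'` of vertices if register 0 holds the length of a list
of vertices, stored from index 0 on in array 0, whose members are the elements of `X'`. -/
def State.Outputs {n : ℕ} (τ : State) (X' : Finset (Fin n)) : Prop :=
  X'.image Fin.val = (Finset.range (τ.reg 0)).image (τ.arr 0)

end EPG

/-! A reflection makes "left and down from the corner" the missing shape, and the corner of a
straight path is taken to be its left or lower end. Let `G` be a maximal set of vertices whose paths
use pairwise different grid lines. Paths that share an edge share a line, so if `|G| ≥ k` then any
`k` members of `G` form a solution, and the first `k` members are selected.

Otherwise `|G| < k`, and every path outside `G` uses a line of some member of `G`. In a solution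
`S`, let `P` have the largest sum of corner coordinates. If `P` lies in `G`, it is selected. If not,
up to transposition `P` has a horizontal arm on a row used by `G`. By the choice of `P`, and of `P`
among solution paths with the same corner, the other members of `S` on this row lie to the left of
the arm of `P`. So `P` may be exchanged for a path `Q` of its class on this row whose arm starts no
further left, as long as the column of `Q` is free. For each class and row, only the best path at
each corner is kept, and of these the `k` that start furthest right. A kept path that is better than
the best exchangeable one has its column occupied by one of the `k - 1` other members of `S`, and
different kept paths have different columns; hence the best exchangeable one is among the `k`
(`exists_ranked`, `exists_rowCand`, `exists_cand`). There are three classes: right without going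
down, right and down, and left. With rows and columns this gives at most `k + 2 * (k - 1) * 3 * k ≤
6 * k ^ 2` vertices (`card_cand_le`), which proves the second claim.

For the decision, the search branches over the selected vertices, deletes the chosen vertex and its
neighbours, and lowers `k` by one. The tree has at most `24 * k ^ (2 * k)` nodes
(`treeSize_le_pow`), each processed in polynomial time.

The machine programs are obtained from a small calculus of polynomial time expressions (`Ev`),
predicates (`Pred`) and memory transformations (`Cmd`). Each closure rule produces the program
together with its time bound, so an algorithm is written as a function on memories and its
correctness is a statement about that function. -/

namespace EPG

/-! ## Programs that compute functions of the memory in polynomial time -/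

/-- The contents of the arrays. -/
abbrev Mem := ℕ → ℕ → ℕ

/-- The size parameter of a memory, kept in entry `0` of array `4`. -/
def Mem.size (m : Mem) : ℕ := m 4 0

/-- Entry `i` of array `a` is replaced by `v`. -/
def Mem.set (m : Mem) (a i v : ℕ) : Mem := Function.update m a (Function.update (m a) i v)

theorem State.setArr_arr (σ : State) (a i v : ℕ) : (σ.setArr a i v).arr = Mem.set σ.arr a i v := rfl

theorem State.setArr_reg (σ : State) (a i v : ℕ) : (σ.setArr a i v).reg = σ.reg := rfl

theorem State.setReg_arr (σ : State) (x v : ℕ) : (σ.setReg x v).arr = σ.arr := rfl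

theorem State.setReg_reg (σ : State) (x v : ℕ) : (σ.setReg x v).reg = Function.update σ.reg x v :=
  rfl

theorem State.setReg_reg_same (σ : State) (x v : ℕ) : (σ.setReg x v).reg x = v := by
  simp [State.setReg]

theorem State.setReg_reg_of_ne (σ : State) {x y : ℕ} (v : ℕ) (h : y ≠ x) :
    (σ.setReg x v).reg y = σ.reg y := by
  simp [State.setReg, h]

/-- Environments that assign values to finitely many variables. -/
class Ctx (E : Type) where
  /-- the number of variables -/
  len : ℕ
  /-- the values of the variables -/
  val : E → ℕ → ℕ

instance : Ctx Unit := ⟨0, fun _ _ => 0⟩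

instance {E : Type} [Ctx E] : Ctx (E × ℕ) :=
  ⟨Ctx.len E + 1, fun e j => if j = Ctx.len E then e.2 else Ctx.val e.1 j⟩

/-- There is a polynomial time program that, given the variables of `e : E` in registers below
`d`, halts with the registers below `d` unchanged, in a state where the old memory, the new memory
and the value of register `d` are related by `Q e`. -/
def Impl {E : Type} [Ctx E] (Q : E → Mem → Mem → ℕ → Prop) : Prop :=
  ∃ T : Polynomial ℕ, ∀ (loc : ℕ → ℕ) (d : ℕ), (∀ j < Ctx.len E, loc j < d) →
    ∃ p : Program, ∀ (e : E) (σ : State), (∀ j < Ctx.len E, σ.reg (loc j) = Ctx.val e j) →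
      ∃ t τ, Exec p σ t τ ∧ t ≤ T.eval (Mem.size σ.arr) ∧ (∀ x < d, τ.reg x = σ.reg x) ∧
        Q e σ.arr τ.arr (τ.reg d)

/-- The function `f` is computable in polynomial time. -/
def Ev {E : Type} [Ctx E] (f : E → Mem → ℕ) : Prop :=
  Impl fun e m m' y => m' = m ∧ y = f e m

/-- The transformation `F` of the memory is computable in polynomial time, and keeps the size. -/
def Cmd {E : Type} [Ctx E] (F : E → Mem → Mem) : Prop :=
  (∀ e m, (F e m).size = m.size) ∧ Impl fun e m m' _ => m' = F e m

/-- Each round lowers `Φ`, so there are at most `Φ σ` rounds and one failing test. In bounded loops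
`Φ` is the distance of the counter to its bound; in the search it is the total size of the pending
trees. -/
theorem exec_while {e₁ e₂ : Expr} {body : Program} {C : ℕ} (Inv : State → Prop) (Φ : State → ℕ)
    (h : ∀ σ, Inv σ → e₁.eval σ < e₂.eval σ →
      ∃ t τ, Exec body σ t τ ∧ t ≤ C ∧ Inv τ ∧ Φ τ < Φ σ) (σ : State) (hσ : Inv σ) :
    ∃ t τ, Exec (.whileLt e₁ e₂ body) σ t τ ∧
      t ≤ Φ σ * (e₁.cost + e₂.cost + 1 + C) + (e₁.cost + e₂.cost + 1) ∧
      Inv τ ∧ ¬ e₁.eval τ < e₂.eval τ := by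
  induction hN : Φ σ using Nat.strong_induction_on generalizing σ with
  | _ N ih =>
    by_cases hc : e₁.eval σ < e₂.eval σ
    · obtain ⟨t, τ, h1, h2, h3, h4⟩ := h σ hσ hc
      obtain ⟨t', τ', g1, g2, g3, g4⟩ := ih (Φ τ) (hN ▸ h4) τ h3 rfl
      refine ⟨_, τ', .whileTrue hc h1 g1, ?_, g3, g4⟩
      have : (Φ τ + 1) * (e₁.cost + e₂.cost + 1 + C) ≤ N * (e₁.cost + e₂.cost + 1 + C) :=
        Nat.mul_le_mul_right _ (by omega)
      rw [add_mul] at this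
      omega
    · exact ⟨_, σ, .whileFalse hc, by omega, hσ, hc⟩

/-! ### Closure rules for polynomial time expressions, commands and predicates -/

section Rules
variable {E : Type} [Ctx E]

theorem Ev.congr {f g : E → Mem → ℕ} (hf : Ev f) (h : ∀ e m, f e m = g e m) : Ev g := by
  have : f = g := by ext; apply h
  exact this ▸ hf

theorem Ev.const (c : ℕ) : Ev fun (_ : E) _ => c := by
  refine ⟨2, fun loc d _ => ⟨.assign d (.const c), fun e σ _ => ⟨_, _, .assign _ _ _, ?_, ?_, rfl, ?_⟩⟩⟩
  · simp [Expr.cost]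
  · intro x hx; exact State.setReg_reg_of_ne _ _ hx.ne
  · simp [State.setReg_reg_same, Expr.eval]

theorem Ev.var : Ev fun (e : E × ℕ) _ => e.2 := by
  refine ⟨2, fun loc d hd => ⟨.assign d (.reg (loc (Ctx.len E))),
    fun e σ hσ => ⟨_, _, .assign _ _ _, ?_, ?_, rfl, ?_⟩⟩⟩
  · simp [Expr.cost]
  · intro x hx; exact State.setReg_reg_of_ne _ _ hx.ne
  · have := hσ (Ctx.len E) (Nat.lt_succ_self _)
    rw [State.setReg_reg_same]
    simpa [Expr.eval, Ctx.val] using this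

theorem Ev.weak {f : E → Mem → ℕ} (hf : Ev f) : Ev fun (e : E × ℕ) m => f e.1 m := by
  obtain ⟨T, hT⟩ := hf
  refine ⟨T, fun loc d hd => ?_⟩
  obtain ⟨p, hp⟩ := hT loc d fun j hj => hd j (Nat.lt_succ_of_lt hj)
  refine ⟨p, fun e σ hσ => hp e.1 σ fun j hj => ?_⟩
  rw [hσ j (Nat.lt_succ_of_lt hj)]
  simp [Ctx.val, hj.ne]

theorem Ev.arr (a : ℕ) {i : E → Mem → ℕ} (hi : Ev i) : Ev fun e m => m a (i e m) := by
  obtain ⟨T, hT⟩ := hi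
  refine ⟨T + 3, fun loc d hd => ?_⟩
  obtain ⟨p, hp⟩ := hT loc d hd
  refine ⟨.seq p (.assign d (.arr a (.reg d))), fun e σ hσ => ?_⟩
  obtain ⟨t, τ, h1, h2, h3, h4, h5⟩ := hp e σ hσ
  refine ⟨_, _, .seq h1 (.assign _ _ _), ?_, ?_, ?_, ?_⟩
  · simp [Expr.cost]; omega
  · intro x hx; rw [State.setReg_reg_of_ne _ _ hx.ne, h3 x hx]
  · rw [State.setReg_arr, h4]
  · rw [State.setReg_reg_same]; simp [Expr.eval, h4, h5]

/-- Two values computed one after the other, in registers `d` and `d + 1`. -/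
theorem Ev.pair {f g : E → Mem → ℕ} (hf : Ev f) (hg : Ev g) :
    ∃ T : Polynomial ℕ, ∀ (loc : ℕ → ℕ) (d : ℕ), (∀ j < Ctx.len E, loc j < d) →
    ∃ p : Program, ∀ (e : E) (σ : State), (∀ j < Ctx.len E, σ.reg (loc j) = Ctx.val e j) →
      ∃ t τ, Exec p σ t τ ∧ t ≤ T.eval (Mem.size σ.arr) ∧ (∀ x < d, τ.reg x = σ.reg x) ∧
        τ.arr = σ.arr ∧ τ.reg d = f e σ.arr ∧ τ.reg (d + 1) = g e σ.arr := by
  obtain ⟨T, hT⟩ := hf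
  obtain ⟨U, hU⟩ := hg
  refine ⟨T + U, fun loc d hd => ?_⟩
  obtain ⟨p, hp⟩ := hT loc d hd
  obtain ⟨q, hq⟩ := hU loc (d + 1) fun j hj => Nat.lt_succ_of_lt (hd j hj)
  refine ⟨.seq p q, fun e σ hσ => ?_⟩
  obtain ⟨t, τ, h1, h2, h3, h4, h5⟩ := hp e σ hσ
  obtain ⟨t', τ', g1, g2, g3, g4, g5⟩ := hq e τ fun j hj => by rw [h3 _ (hd j hj), hσ j hj]
  rw [h4] at g2 g4 g5
  refine ⟨_, _, .seq h1 g1, ?_, ?_, g4, ?_, g5⟩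
  · simp; omega
  · intro x hx; rw [g3 x (by omega), h3 x hx]
  · rw [g3 d (by omega), h5]

theorem Ev.add {f g : E → Mem → ℕ} (hf : Ev f) (hg : Ev g) : Ev fun e m => f e m + g e m := by
  obtain ⟨T, hT⟩ := hf.pair hg
  refine ⟨T + 4, fun loc d hd => ?_⟩
  obtain ⟨p, hp⟩ := hT loc d hd
  refine ⟨.seq p (.assign d (.add (.reg d) (.reg (d + 1)))), fun e σ hσ => ?_⟩
  obtain ⟨t, τ, h1, h2, h3, h4, h5, h6⟩ := hp e σ hσ
  refine ⟨_, _, .seq h1 (.assign _ _ _), ?_, ?_, ?_, ?_⟩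
  · simp [Expr.cost]; omega
  · intro x hx; rw [State.setReg_reg_of_ne _ _ hx.ne, h3 x hx]
  · rw [State.setReg_arr, h4]
  · rw [State.setReg_reg_same]; simp [Expr.eval, h5, h6]

theorem Ev.sub {f g : E → Mem → ℕ} (hf : Ev f) (hg : Ev g) : Ev fun e m => f e m - g e m := by
  obtain ⟨T, hT⟩ := hf.pair hg
  refine ⟨T + 4, fun loc d hd => ?_⟩
  obtain ⟨p, hp⟩ := hT loc d hd
  refine ⟨.seq p (.assign d (.sub (.reg d) (.reg (d + 1)))), fun e σ hσ => ?_⟩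
  obtain ⟨t, τ, h1, h2, h3, h4, h5, h6⟩ := hp e σ hσ
  refine ⟨_, _, .seq h1 (.assign _ _ _), ?_, ?_, ?_, ?_⟩
  · simp [Expr.cost]; omega
  · intro x hx; rw [State.setReg_reg_of_ne _ _ hx.ne, h3 x hx]
  · rw [State.setReg_arr, h4]
  · rw [State.setReg_reg_same]; simp [Expr.eval, h5, h6]

theorem Ev.iteLt {f g u v : E → Mem → ℕ} (hf : Ev f) (hg : Ev g) (hu : Ev u) (hv : Ev v) :
    Ev fun e m => if f e m < g e m then u e m else v e m := by
  obtain ⟨T, hT⟩ := hf.pair hg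
  obtain ⟨U, hU⟩ := hu
  obtain ⟨V, hV⟩ := hv
  refine ⟨T + U + V + 3, fun loc d hd => ?_⟩
  obtain ⟨p, hp⟩ := hT loc d hd
  obtain ⟨q, hq⟩ := hU loc d hd
  obtain ⟨r, hr⟩ := hV loc d hd
  refine ⟨.seq p (.ifLt (.reg d) (.reg (d + 1)) q r), fun e σ hσ => ?_⟩
  obtain ⟨t, τ, h1, h2, h3, h4, h5, h6⟩ := hp e σ hσ
  have hτ : ∀ j < Ctx.len E, τ.reg (loc j) = Ctx.val e j := fun j hj => by
    rw [h3 _ (hd j hj), hσ j hj]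
  by_cases hc : f e σ.arr < g e σ.arr
  · obtain ⟨t', τ', g1, g2, g3, g4, g5⟩ := hq e τ hτ
    rw [h4] at g2 g4 g5
    refine ⟨_, _, .seq h1 (.ifTrue (by simpa [Expr.eval, h5, h6] using hc) g1), ?_, ?_, g4, ?_⟩
    · simp [Expr.cost]; omega
    · intro x hx; rw [g3 x hx, h3 x hx]
    · simp only [g5, if_pos hc]
  · obtain ⟨t', τ', g1, g2, g3, g4, g5⟩ := hr e τ hτ
    rw [h4] at g2 g4 g5
    refine ⟨_, _, .seq h1 (.ifFalse (by simpa [Expr.eval, h5, h6] using hc) g1), ?_, ?_, g4, ?_⟩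
    · simp [Expr.cost]; omega
    · intro x hx; rw [g3 x hx, h3 x hx]
    · simp only [g5, if_neg hc]

/-- A loop over `i < size`. The body also receives the value `y` of register `d`, and may
change it. -/
theorem impl_loop {Q : E → ℕ → Mem → ℕ → Mem → ℕ → Prop}
    (hQ : ∀ e i m y m' y', Q e i m y m' y' → m'.size = m.size)
    (h : ∃ T : Polynomial ℕ, ∀ (loc : ℕ → ℕ) (d : ℕ), (∀ j < Ctx.len (E × ℕ), loc j < d) →
      ∀ acc < d, loc (Ctx.len E) ≠ acc → (∀ j < Ctx.len E, loc j ≠ acc) →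
      ∃ p : Program, ∀ (e : E) (i : ℕ) (σ : State),
        (∀ j < Ctx.len (E × ℕ), σ.reg (loc j) = Ctx.val (e, i) j) →
        ∃ t τ, Exec p σ t τ ∧ t ≤ T.eval (Mem.size σ.arr) ∧
          (∀ x < d, x ≠ acc → τ.reg x = σ.reg x) ∧
          Q e i σ.arr (σ.reg acc) τ.arr (τ.reg acc)) :
    Impl fun (e : E) m m' y => ∃ (M : ℕ → Mem) (Y : ℕ → ℕ), M 0 = m ∧ Y 0 = 0 ∧
      M m.size = m' ∧ Y m.size = y ∧ ∀ i < m.size, Q e i (M i) (Y i) (M (i + 1)) (Y (i + 1)) := by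
  obtain ⟨T, hT⟩ := h
  -- A round costs 3 for the test, `T` for the body and 4 for the increment; the three initial
  -- assignments cost 7 and the failing test 3. Register `d` is the accumulator, `d + 1` the counter
  -- and `d + 2` the bound, so the body works from `d + 3` on.
  refine ⟨Polynomial.X * (T + 7) + 10, fun loc d hd => ?_⟩
  obtain ⟨p, hp⟩ := hT (Function.update loc (Ctx.len E) (d + 1)) (d + 3) (fun j hj => by
      rcases eq_or_ne j (Ctx.len E) with rfl | hne
      · simp
      · have : j < Ctx.len E := lt_of_le_of_ne (Nat.lt_succ_iff.1 hj) hne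
        simp only [Function.update_of_ne hne]
        have := hd j this
        omega) d (by omega) (by simp) (fun j hj => by
        rw [Function.update_of_ne hj.ne]; exact (hd j hj).ne)
  refine ⟨.seq (.assign d (.const 0)) (.seq (.assign (d + 1) (.const 0))
    (.seq (.assign (d + 2) (.arr 4 (.const 0)))
      (.whileLt (.reg (d + 1)) (.reg (d + 2))
        (.seq p (.assign (d + 1) (.add (.reg (d + 1)) (.const 1))))))), fun e σ hσ => ?_⟩
  set N := Mem.size σ.arr with hN
  let Inv : State → Prop := fun τ => Mem.size τ.arr = N ∧ τ.reg (d + 1) ≤ N ∧ τ.reg (d + 2) = N ∧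
    (∀ x < d, τ.reg x = σ.reg x) ∧ ∃ (M : ℕ → Mem) (Y : ℕ → ℕ), M 0 = σ.arr ∧ Y 0 = 0 ∧
      M (τ.reg (d + 1)) = τ.arr ∧ Y (τ.reg (d + 1)) = τ.reg d ∧
      ∀ i < τ.reg (d + 1), Q e i (M i) (Y i) (M (i + 1)) (Y (i + 1))
  obtain ⟨t, τ, h1, h2, ⟨h3, h4, h5, h6, M, Y, h7, h8, h9, h10, h11⟩, h12⟩ := exec_while
    (e₁ := .reg (d + 1)) (e₂ := .reg (d + 2))
    (body := .seq p (.assign (d + 1) (.add (.reg (d + 1)) (.const 1)))) (C := T.eval N + 4) Inv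
    (fun τ => N - τ.reg (d + 1)) (by
      rintro τ ⟨h1, h2, h3, h4, M, Y, h5, h6, h7, h8, h9⟩ hc
      simp only [Expr.eval, h3] at hc
      obtain ⟨t, ρ, g1, g2, g3, g4⟩ := hp e (τ.reg (d + 1)) τ (fun j hj => by
        rcases eq_or_ne j (Ctx.len E) with rfl | hne
        · simp [Ctx.val]
        · have : j < Ctx.len E := lt_of_le_of_ne (Nat.lt_succ_iff.1 hj) hne
          simp only [Function.update_of_ne hne, Ctx.val, if_neg hne]
          rw [h4 _ (hd j this), hσ j this])
      rw [h1] at g2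
      have e1 : ρ.reg (d + 1) = τ.reg (d + 1) := g3 _ (by omega) (by omega)
      refine ⟨_, _, .seq g1 (.assign _ _ _), ?_, ⟨?_, ?_, ?_, ?_, ?_⟩, ?_⟩
      · simp [Expr.cost]; omega
      · rw [State.setReg_arr, hQ _ _ _ _ _ _ g4, h1]
      · rw [State.setReg_reg_same]; simp only [Expr.eval, e1]; omega
      · rw [State.setReg_reg_of_ne _ _ (by omega), g3 _ (by omega) (by omega), h3]
      · intro x hx
        rw [State.setReg_reg_of_ne _ _ (by omega), g3 _ (by omega) (by omega), h4 x hx]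
      · rw [State.setReg_reg_same, State.setReg_arr, State.setReg_reg_of_ne _ _ (by omega)]
        simp only [Expr.eval, e1]
        -- The recorded history of memories and accumulator values is prolonged by the outcome of
        -- this round.
        refine ⟨fun i => if i ≤ τ.reg (d + 1) then M i else ρ.arr,
          fun i => if i ≤ τ.reg (d + 1) then Y i else ρ.reg d, by simp [h5], by simp [h6],
          by simp, by simp, fun i hi => ?_⟩
        rcases (Nat.lt_succ_iff.1 hi).lt_or_eq with hi | rfl
        · simpa [hi.le, Nat.succ_le_of_lt hi] using h9 i hi
        · simpa [h7, h8] using g4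
      · rw [State.setReg_reg_same]; simp only [Expr.eval, e1]; omega)
    (((σ.setReg d 0).setReg (d + 1) 0).setReg (d + 2) N) (by
      refine ⟨rfl, ?_, ?_, ?_, fun _ => σ.arr, fun _ => 0, rfl, rfl, rfl, ?_, ?_⟩
      · simp [State.setReg_reg]
      · simp [State.setReg_reg]
      · intro x hx
        rw [State.setReg_reg_of_ne _ _ (by omega), State.setReg_reg_of_ne _ _ (by omega),
          State.setReg_reg_of_ne _ _ (by omega)]
      · simp [State.setReg_reg]
      · simp [State.setReg_reg])
  refine ⟨_, τ, .seq (.assign _ _ _) (.seq (.assign _ _ _) (.seq (.assign _ _ _) h1)), ?_, h6, ?_⟩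
  · simp only [State.setReg_reg, Expr.cost] at h2 ⊢
    simp at h2 ⊢
    ring_nf at h2 ⊢
    omega
  · simp only [Expr.eval, h5] at h12
    have h13 : τ.reg (d + 1) = N := by omega
    rw [h13] at h9 h10 h11
    exact ⟨M, Y, h7, h8, h9, h10, h11⟩

theorem Ev.sum {f : E → ℕ → Mem → ℕ} (hf : Ev fun (e : E × ℕ) m => f e.1 e.2 m) :
    Ev fun e m => ∑ i ∈ Finset.range m.size, f e i m := by
  have := impl_loop (E := E) (Q := fun e i m y m' y' => m' = m ∧ y' = y + f e i m)
    (by rintro e i m y m' y' ⟨rfl, -⟩; rfl) (by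
      obtain ⟨T, hT⟩ := hf
      refine ⟨T + 4, fun loc d hd acc hacc _ _ => ?_⟩
      obtain ⟨p, hp⟩ := hT loc d hd
      refine ⟨.seq p (.assign acc (.add (.reg acc) (.reg d))), fun e i σ hσ => ?_⟩
      obtain ⟨t, τ, h1, h2, h3, h4, h5⟩ := hp (e, i) σ hσ
      refine ⟨_, _, .seq h1 (.assign _ _ _), ?_, ?_, ?_, ?_⟩
      · simp [Expr.cost]; omega
      · intro x hx hne; rw [State.setReg_reg_of_ne _ _ hne, h3 x hx]
      · rw [State.setReg_arr, h4]
      · rw [State.setReg_reg_same]; simp [Expr.eval, h5, h3 acc hacc])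
  obtain ⟨T, hT⟩ := this
  refine ⟨T, fun loc d hd => ?_⟩
  obtain ⟨p, hp⟩ := hT loc d hd
  refine ⟨p, fun e σ hσ => ?_⟩
  obtain ⟨t, τ, h1, h2, h3, M, Y, g1, g2, g3, g4, g5⟩ := hp e σ hσ
  have key : ∀ i ≤ Mem.size σ.arr, M i = σ.arr ∧ Y i = ∑ j ∈ Finset.range i, f e j σ.arr := by
    intro i
    induction i with
    | zero => intro; simp [g1, g2]
    | succ i ih =>
      intro hi
      obtain ⟨e1, e2⟩ := ih (by omega)
      obtain ⟨e3, e4⟩ := g5 i (by omega)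
      rw [e1] at e3 e4
      exact ⟨e3, by rw [e4, e2, Finset.sum_range_succ]⟩
  obtain ⟨e1, e2⟩ := key _ le_rfl
  exact ⟨t, τ, h1, h2, h3, by rw [← g3, e1], by rw [← g4, e2]⟩

/-- `F i` is applied for `i = 0, 1, …, n - 1` in turn. -/
def iter (F : ℕ → Mem → Mem) (n : ℕ) (m : Mem) : Mem := Nat.rec m (fun i m' => F i m') n

theorem iter_zero (F : ℕ → Mem → Mem) (m : Mem) : iter F 0 m = m := rfl

theorem iter_succ (F : ℕ → Mem → Mem) (n : ℕ) (m : Mem) : iter F (n + 1) m = F n (iter F n m) := rfl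

theorem Cmd.forLoop {F : E → ℕ → Mem → Mem} (hF : Cmd fun (e : E × ℕ) m => F e.1 e.2 m) :
    Cmd fun e m => iter (F e) m.size m := by
  have hsize : ∀ e i (m : Mem), (F e i m).size = m.size := fun e i m => hF.1 (e, i) m
  refine ⟨fun e m => ?_, ?_⟩
  · suffices ∀ i, (iter (F e) i m).size = m.size from this _
    intro i
    induction i with
    | zero => rfl
    | succ i ih => rw [iter_succ, hsize, ih]
  have := impl_loop (E := E) (Q := fun e i m _ m' _ => m' = F e i m)
    (by rintro e i m y m' y' rfl; exact hsize e i m) (by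
      obtain ⟨-, T, hT⟩ := hF
      refine ⟨T, fun loc d hd acc hacc _ _ => ?_⟩
      obtain ⟨p, hp⟩ := hT loc d hd
      refine ⟨p, fun e i σ hσ => ?_⟩
      obtain ⟨t, τ, h1, h2, h3, h4⟩ := hp (e, i) σ hσ
      exact ⟨t, τ, h1, h2, fun x hx _ => h3 x hx, h4⟩)
  obtain ⟨T, hT⟩ := this
  refine ⟨T, fun loc d hd => ?_⟩
  obtain ⟨p, hp⟩ := hT loc d hd
  refine ⟨p, fun e σ hσ => ?_⟩
  obtain ⟨t, τ, h1, h2, h3, M, Y, g1, g2, g3, g4, g5⟩ := hp e σ hσ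
  refine ⟨t, τ, h1, h2, h3, ?_⟩
  suffices ∀ i ≤ Mem.size σ.arr, M i = iter (F e) i σ.arr by rw [← g3, this _ le_rfl]
  intro i
  induction i with
  | zero => intro; rw [g1, iter_zero]
  | succ i ih => intro hi; rw [g5 i (by omega), ih (by omega), iter_succ]

theorem Cmd.store {i v : E → Mem → ℕ} (a : ℕ) (hi : Ev i) (hv : Ev v)
    (h : a ≠ 4 ∨ ∀ e m, i e m ≠ 0) : Cmd fun e m => m.set a (i e m) (v e m) := by
  refine ⟨fun e m => ?_, ?_⟩
  · rcases h with h | h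
    · simp [Mem.size, Mem.set, Function.update_of_ne h.symm]
    · rcases eq_or_ne a 4 with rfl | h'
      · simp [Mem.size, Mem.set, Function.update_of_ne (h e m).symm]
      · simp [Mem.size, Mem.set, Function.update_of_ne h'.symm]
  obtain ⟨T, hT⟩ := hi.pair hv
  refine ⟨T + 3, fun loc d hd => ?_⟩
  obtain ⟨p, hp⟩ := hT loc d hd
  refine ⟨.seq p (.store a (.reg d) (.reg (d + 1))), fun e σ hσ => ?_⟩
  obtain ⟨t, τ, h1, h2, h3, h4, h5, h6⟩ := hp e σ hσ
  refine ⟨_, _, .seq h1 (.store _ _ _ _), ?_, ?_, ?_⟩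
  · simp [Expr.cost]; omega
  · intro x hx; rw [State.setArr_reg, h3 x hx]
  · rw [State.setArr_arr]; simp [Expr.eval, h4, h5, h6]

theorem Cmd.comp {F G : E → Mem → Mem} (hF : Cmd F) (hG : Cmd G) :
    Cmd fun e m => G e (F e m) := by
  refine ⟨fun e m => by rw [hG.1, hF.1], ?_⟩
  obtain ⟨hs, T, hT⟩ := hF
  obtain ⟨-, U, hU⟩ := hG
  refine ⟨T + U, fun loc d hd => ?_⟩
  obtain ⟨p, hp⟩ := hT loc d hd
  obtain ⟨q, hq⟩ := hU loc d hd
  refine ⟨.seq p q, fun e σ hσ => ?_⟩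
  obtain ⟨t, τ, h1, h2, h3, h4⟩ := hp e σ hσ
  obtain ⟨t', τ', g1, g2, g3, g4⟩ := hq e τ fun j hj => by rw [h3 _ (hd j hj), hσ j hj]
  rw [h4, hs] at g2
  refine ⟨_, _, .seq h1 g1, ?_, ?_, by rw [g4, h4]⟩
  · simp; omega
  · intro x hx; rw [g3 x hx, h3 x hx]

/-- The number `1` if the proposition `p` holds, and `0` otherwise. -/
noncomputable def ind (p : Prop) : ℕ := open Classical in if p then 1 else 0

theorem ind_def (p : Prop) [Decidable p] : ind p = if p then 1 else 0 := by
  unfold ind; congr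

/-- The predicate `P` is decidable in polynomial time. -/
def Pred (P : E → Mem → Prop) : Prop := Ev fun e m => ind (P e m)

theorem Pred.congr {P Q : E → Mem → Prop} (hP : Pred P) (h : ∀ e m, P e m ↔ Q e m) : Pred Q := by
  have : P = Q := by ext; apply h
  exact this ▸ hP

theorem Pred.lt {f g : E → Mem → ℕ} (hf : Ev f) (hg : Ev g) : Pred fun e m => f e m < g e m :=
  (Ev.iteLt hf hg (.const 1) (.const 0)).congr fun _ _ => (ind_def _).symm

theorem Ev.ite {P : E → Mem → Prop} {f g : E → Mem → ℕ} (hP : Pred P) (hf : Ev f) (hg : Ev g)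
    {_ : ∀ e m, Decidable (P e m)} : Ev fun e m => if P e m then f e m else g e m :=
  (Ev.iteLt (.const 0) hP hf hg).congr fun e m => by by_cases h : P e m <;> simp [h, ind_def]

theorem Pred.not {P : E → Mem → Prop} (hP : Pred P) : Pred fun e m => ¬ P e m :=
  (Pred.lt hP (.const 1)).congr fun e m => by by_cases h : P e m <;> simp [h, ind_def]

theorem Pred.and {P Q : E → Mem → Prop} (hP : Pred P) (hQ : Pred Q) :
    Pred fun e m => P e m ∧ Q e m :=
  (Pred.lt (.const 1) (Ev.add hP hQ)).congr fun e m => by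
    by_cases h : P e m <;> by_cases h' : Q e m <;> simp [h, h', ind_def]

theorem Pred.or {P Q : E → Mem → Prop} (hP : Pred P) (hQ : Pred Q) :
    Pred fun e m => P e m ∨ Q e m :=
  (hP.not.and hQ.not).not.congr fun e m => by tauto

theorem Pred.imp {P Q : E → Mem → Prop} (hP : Pred P) (hQ : Pred Q) :
    Pred fun e m => P e m → Q e m :=
  (hP.and hQ.not).not.congr fun e m => by tauto

theorem Pred.le {f g : E → Mem → ℕ} (hf : Ev f) (hg : Ev g) : Pred fun e m => f e m ≤ g e m :=
  (Pred.lt hg hf).not.congr fun _ _ => not_lt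

theorem Pred.eq {f g : E → Mem → ℕ} (hf : Ev f) (hg : Ev g) : Pred fun e m => f e m = g e m :=
  ((Pred.le hf hg).and (Pred.le hg hf)).congr fun _ _ => le_antisymm_iff.symm

/-- The search is a sum of indicators over the whole range, compared with zero; no early exit is
needed. -/
theorem Pred.ex {P : E → ℕ → Mem → Prop} (hP : Pred fun (e : E × ℕ) m => P e.1 e.2 m) :
    Pred fun e m => ∃ i < m.size, P e i m :=
  (Pred.lt (.const 0) (Ev.sum (f := fun e i m => ind (P e i m)) hP)).congr fun e m => by
    classical
    simp only [ind_def, Finset.sum_boole]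
    simp [Finset.card_pos, Finset.Nonempty]

theorem Pred.all {P : E → ℕ → Mem → Prop} (hP : Pred fun (e : E × ℕ) m => P e.1 e.2 m) :
    Pred fun e m => ∀ i < m.size, P e i m :=
  (Pred.ex (P := fun e i m => ¬ P e i m) hP.not).not.congr fun e m => by push Not; rfl

theorem Ev.card {P : E → ℕ → Mem → Prop} (hP : Pred fun (e : E × ℕ) m => P e.1 e.2 m)
    {_ : ∀ e m, DecidablePred fun i => P e i m} :
    Ev fun e m => ((Finset.range m.size).filter fun i => P e i m).card :=
  (Ev.sum (f := fun e i m => ind (P e i m)) hP).congr fun e m => by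
    simp only [ind_def, Finset.sum_boole, Nat.cast_id]

theorem Ev.min {f g : E → Mem → ℕ} (hf : Ev f) (hg : Ev g) : Ev fun e m => min (f e m) (g e m) :=
  (Ev.iteLt hf hg hf hg).congr fun e m => by split_ifs <;> omega

theorem Ev.max {f g : E → Mem → ℕ} (hf : Ev f) (hg : Ev g) : Ev fun e m => max (f e m) (g e m) :=
  (Ev.iteLt hf hg hg hf).congr fun e m => by split_ifs <;> omega

theorem Ev.size : Ev fun (_ : E) m => m.size := Ev.arr 4 (.const 0)

end Rules


/-! ## Selecting few vertices of which one lies in a solution -/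

/-- The segments with ends `x, y` and `x', y'` on a line share a unit interval. -/
def Overlap (x y x' y' : ℕ) : Prop := max (min x y) (min x' y') < min (max x y) (max x' y')

/-- The paths `u` and `v` share a grid edge. Their corners are at `(a, b)`, their ends at `(h, b)`
and `(a, t)`. -/
def Conf (a b h t : ℕ → ℕ) (u v : ℕ) : Prop :=
  (b u = b v ∧ Overlap (a u) (h u) (a v) (h v)) ∨ (a u = a v ∧ Overlap (b u) (t u) (b v) (t v))

/-- The paths `u` and `v` use a common line of the grid. -/
def Share (a b h t : ℕ → ℕ) (u v : ℕ) : Prop :=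
  (b u = b v ∧ a u ≠ h u ∧ a v ≠ h v) ∨ (a u = a v ∧ b u ≠ t u ∧ b v ≠ t v)

/-- No two elements of `S` are related by `C`. -/
def Indep (C : ℕ → ℕ → Prop) (S : Finset ℕ) : Prop := ∀ u ∈ S, ∀ v ∈ S, u ≠ v → ¬ C u v

/-- `S` is an independent set of size `k` inside `A`. -/
def IsSol (C : ℕ → ℕ → Prop) (A : ℕ → Prop) (k : ℕ) (S : Finset ℕ) : Prop :=
  (∀ v ∈ S, A v) ∧ S.card = k ∧ Indep C S

theorem Conf.symm {a b h t : ℕ → ℕ} {u v : ℕ} (H : Conf a b h t u v) : Conf a b h t v u := by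
  unfold Conf Overlap at *; omega

theorem conf_transpose {a b h t : ℕ → ℕ} : Conf b a t h = Conf a b h t := by
  ext u v; unfold Conf; tauto

theorem Overlap.ne {x y x' y' : ℕ} (H : Overlap x y x' y') : x ≠ y ∧ x' ≠ y' := by
  unfold Overlap at H; omega

theorem overlap_reflect {M x y x' y' : ℕ} (hx : x ≤ M) (hy : y ≤ M) (hx' : x' ≤ M)
    (hy' : y' ≤ M) : Overlap (M - x) (M - y) (M - x') (M - y') ↔ Overlap x y x' y' := by
  have e1 : ∀ p q : ℕ, min (M - p) (M - q) = M - max p q := by omega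
  have e2 : ∀ p q : ℕ, max (M - p) (M - q) = M - min p q := by omega
  have h1 : max x y ≤ M := max_le hx hy
  have h2 : max x' y' ≤ M := max_le hx' hy'
  unfold Overlap
  simp only [e1, e2]
  omega

theorem not_conf {a b h t : ℕ → ℕ} {u v : ℕ} (H : ¬ Conf a b h t u v) :
    (b u = b v → ¬ Overlap (a u) (h u) (a v) (h v)) ∧
      (a u = a v → ¬ Overlap (b u) (t u) (b v) (t v)) :=
  ⟨fun e o => H (Or.inl ⟨e, o⟩), fun e o => H (Or.inr ⟨e, o⟩)⟩

theorem Conf.share {a b h t : ℕ → ℕ} {u v : ℕ} (H : Conf a b h t u v) : Share a b h t u v := by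
  unfold Conf Overlap at H; unfold Share; omega

/-- `u` precedes `v` in the order by decreasing `g`, with ties broken by index. -/
def Beats (g : ℕ → ℕ) (u v : ℕ) : Prop := g v < g u ∨ g u = g v ∧ u < v

/-- Among the paths in the class `K` with the same corner, `v` is the first that minimizes `d`. -/
def Rep (n : ℕ) (A K : ℕ → Prop) (a b d : ℕ → ℕ) (v : ℕ) : Prop :=
  (A v ∧ K v) ∧ ∀ u < n, A u ∧ K u → a u = a v ∧ b u = b v → ¬ (d u < d v ∨ d u = d v ∧ u < v)

open Classical in
/-- `v` is one of the `k` representatives in its row for which `g` is largest. -/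
def Ranked (n k : ℕ) (A K : ℕ → Prop) (a b d g : ℕ → ℕ) (v : ℕ) : Prop :=
  Rep n A K a b d v ∧
    ((Finset.range n).filter fun u => (Rep n A K a b d u ∧ b u = b v) ∧ Beats g u v).card < k

/-- The number of predecessors is strictly increasing along a strict total order, hence injective,
and here it takes values below `k`. -/
theorem card_filter_rank_lt (F : Finset ℕ) (r : ℕ → ℕ → Prop) (k : ℕ) [DecidableRel r]
    (irrefl : ∀ u ∈ F, ¬ r u u) (trans : ∀ u ∈ F, ∀ v ∈ F, ∀ w ∈ F, r u v → r v w → r u w)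
    (total : ∀ u ∈ F, ∀ v ∈ F, u ≠ v → r u v ∨ r v u) :
    (F.filter fun v => (F.filter fun u => r u v).card < k).card ≤ k := by
  have key : ∀ v ∈ F, ∀ w ∈ F, r v w →
      (F.filter fun u => r u v).card < (F.filter fun u => r u w).card := by
    intro v hv w hw h
    apply Finset.card_lt_card
    rw [Finset.ssubset_iff_of_subset]
    · exact ⟨v, by simp [hv, h], by simp [irrefl v hv]⟩
    · intro u hu
      simp only [Finset.mem_filter] at hu ⊢
      exact ⟨hu.1, trans u hu.1 v hv w hw hu.2 h⟩
  conv_rhs => rw [← Finset.card_range k]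
  apply Finset.card_le_card_of_injOn fun v => (F.filter fun u => r u v).card
  · intro v hv
    simp only [Finset.coe_filter, Set.mem_ofPred_eq] at hv
    simpa using hv.2
  · intro v hv w hw h
    simp only [Finset.coe_filter, Set.mem_ofPred_eq] at hv hw
    by_contra hne
    rcases total v hv.1 w hw.1 hne with h' | h'
    · exact (key v hv.1 w hw.1 h').ne h
    · exact (key w hw.1 v hv.1 h').ne' h

theorem Beats.trans {g : ℕ → ℕ} {u v w : ℕ} (h : Beats g u v) (h' : Beats g v w) :
    Beats g u w := by
  unfold Beats at *; omega

theorem beats_irrefl {g : ℕ → ℕ} {u : ℕ} : ¬ Beats g u u := by unfold Beats; omega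

theorem beats_total {g : ℕ → ℕ} {u v : ℕ} (h : u ≠ v) : Beats g u v ∨ Beats g v u := by
  unfold Beats; omega

theorem exists_first {U : Finset ℕ} (hU : U.Nonempty) (g : ℕ → ℕ) :
    ∃ v ∈ U, ∀ u ∈ U, ¬ Beats g u v := by
  obtain ⟨w, hw, hmax⟩ := U.exists_max_image g hU
  obtain ⟨v, hv, hmin⟩ := (U.filter fun u => g u = g w).exists_min_image id ⟨w, by simp [hw]⟩
  simp only [Finset.mem_filter, id] at hv hmin
  refine ⟨v, hv.1, fun u hu h => ?_⟩
  have h1 := hmax u hu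
  have h2 := hmin u
  unfold Beats at h
  have := h2 ⟨hu, by omega⟩
  omega

theorem Rep.eq {n : ℕ} {A K : ℕ → Prop} {a b d : ℕ → ℕ} {u v : ℕ} (hA : ∀ v, A v → v < n)
    (hu : Rep n A K a b d u) (hv : Rep n A K a b d v) (ha : a u = a v) (hb : b u = b v) :
    u = v := by
  have h1 := hu.2 v (hA v hv.1.1) hv.1 ⟨ha.symm, hb.symm⟩
  have h2 := hv.2 u (hA u hu.1.1) hu.1 ⟨ha, hb⟩
  omega

theorem exists_rep {n : ℕ} {A K : ℕ → Prop} {a b d : ℕ → ℕ} {v : ℕ} (hA : ∀ v, A v → v < n)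
    (h : A v) (hK : K v) : ∃ u, Rep n A K a b d u ∧ a u = a v ∧ b u = b v ∧ d u ≤ d v := by
  classical
  let U := (Finset.range n).filter fun u => (A u ∧ K u) ∧ a u = a v ∧ b u = b v
  have hv : v ∈ U := by simp [U, h, hK, hA v h]
  obtain ⟨w, hw, hmin⟩ := U.exists_min_image d ⟨v, hv⟩
  obtain ⟨x, hx, hx'⟩ := (U.filter fun u => d u = d w).exists_min_image id ⟨w, by simp [hw]⟩
  simp only [Finset.mem_filter, id] at hx hx'
  have hxU := hx.1
  simp only [U, Finset.mem_filter] at hxU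
  refine ⟨x, ⟨hxU.2.1, fun u hu hAK huv hlt => ?_⟩, hxU.2.2.1, hxU.2.2.2, by
    rw [hx.2]; exact hmin v hv⟩
  have huU : u ∈ U := by
    simp only [U, Finset.mem_filter, Finset.mem_range]
    exact ⟨hu, hAK, by omega, by omega⟩
  have h1 := hmin u huU
  have := hx' u ⟨huU, by omega⟩
  omega

/-- If `P` in the solution `S` can be exchanged for every `Q` of its class in its row for which `g`
is no smaller and whose column is free (or whose corner is that of `P`), then it can be exchanged
for a ranked vertex. -/
theorem exists_ranked {C : ℕ → ℕ → Prop} {n k : ℕ} {A K : ℕ → Prop} {a b d g : ℕ → ℕ}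
    {S : Finset ℕ} {P : ℕ} {used : ℕ → Prop} (hC : ∀ u v, C u v → C v u)
    (hA : ∀ v, A v → v < n) (hS : IsSol C A k S) (hP : P ∈ S) (hK : K P)
    (hg : ∀ u v, K u → K v → a u = a v → b u = b v → d u ≤ d v → g v ≤ g u)
    (hswap : ∀ Q, A Q → K Q → b Q = b P → g P ≤ g Q →
      ((a Q = a P ∧ d Q ≤ d P) ∨ ∀ u ∈ S, u ≠ P → used u → a u ≠ a Q) →
      ∀ u ∈ S, u ≠ P → u ≠ Q → ¬ C Q u) :
    ∃ Q, Ranked n k A K a b d g Q ∧ b Q = b P ∧ ∃ S', IsSol C A k S' ∧ Q ∈ S' := by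
  classical
  obtain ⟨hSA, hSk, hSI⟩ := hS
  obtain ⟨P', hP', haP, hbP, hdP⟩ := exists_rep (d := d) (b := b) (a := a) hA (hSA P hP) hK
  have hgP := hg P' P hP'.1.2 hK haP hbP hdP
  -- The admissible exchange partners: the representative at the corner of `P`, and the better ones
  -- in the row whose column is free. The first of them is the required `Q`.
  let U := (Finset.range n).filter fun v => Rep n A K a b d v ∧ b v = b P ∧
    (v = P' ∨ Beats g v P' ∧ ∀ u ∈ S, u ≠ P → used u → a u ≠ a v)
  obtain ⟨Q, hQ, hfirst⟩ := exists_first (U := U) ⟨P', by simp [U, hP', hbP, hA P' hP'.1.1]⟩ g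
  simp only [U, Finset.mem_filter, Finset.mem_range] at hQ
  obtain ⟨hQn, hQr, hQb, hQ'⟩ := hQ
  refine ⟨Q, ⟨hQr, ?_⟩, hQb, ?_⟩
  -- A representative that beats `Q` is not admissible, so its column contains the corner of some
  -- member of `S` other than `P`. Representatives in one row with the same column coincide, so
  -- choosing such members is injective and `Q` is beaten fewer than `k` times.
  · have hbl : ∀ u, (u < n ∧ (Rep n A K a b d u ∧ b u = b Q) ∧ Beats g u Q) →
        ∃ s ∈ S.erase P, a s = a u := by
      rintro u ⟨hun, ⟨hur, hub⟩, huQ⟩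
      by_contra hno
      push Not at hno
      refine hfirst u ?_ huQ
      simp only [U, Finset.mem_filter, Finset.mem_range]
      refine ⟨hun, hur, hub.trans hQb, Or.inr ⟨?_, fun s hs hne _ =>
        hno s (Finset.mem_erase.2 ⟨hne, hs⟩)⟩⟩
      rcases hQ' with rfl | h
      · exact huQ
      · exact huQ.trans h.1
    choose! f hf hf' using hbl
    calc _ ≤ (S.erase P).card := by
          apply Finset.card_le_card_of_injOn f
          · intro u hu
            simp only [Finset.coe_filter, Set.mem_ofPred_eq, Finset.mem_range] at hu
            exact hf u hu
          · intro u hu v hv huv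
            simp only [Finset.coe_filter, Set.mem_ofPred_eq, Finset.mem_range] at hu hv
            exact hu.2.1.1.eq hA hv.2.1.1 (by rw [← hf' u hu, ← hf' v hv, huv])
              (by rw [hu.2.1.2, hv.2.1.2])
      _ < k := by rw [← hSk]; exact Finset.card_erase_lt_of_mem hP
  · by_cases hQS : Q ∈ S
    · exact ⟨S, ⟨hSA, hSk, hSI⟩, hQS⟩
    have hnew : ∀ u ∈ S, u ≠ P → ¬ C Q u := by
      intro u hu hne
      refine hswap Q hQr.1.1 hQr.1.2 hQb ?_ ?_ u hu hne (by rintro rfl; exact hQS hu)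
      · rcases hQ' with rfl | h
        · exact hgP
        · rcases h.1 with h | h <;> omega
      · rcases hQ' with rfl | h
        · exact Or.inl ⟨haP, hdP⟩
        · exact Or.inr h.2
    refine ⟨insert Q (S.erase P), ⟨?_, ?_, ?_⟩, Finset.mem_insert_self _ _⟩
    · intro v hv
      rcases Finset.mem_insert.1 hv with rfl | hv
      · exact hQr.1.1
      · exact hSA v (Finset.mem_of_mem_erase hv)
    · rw [Finset.card_insert_of_notMem (by simp [hQS]), Finset.card_erase_add_one hP, hSk]
    · intro u hu v hv huv
      rcases Finset.mem_insert.1 hu with hu | hu <;> rcases Finset.mem_insert.1 hv with hv | hv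
      · exact absurd (hu.trans hv.symm) huv
      · exact hu ▸ hnew v (Finset.mem_of_mem_erase hv) (Finset.ne_of_mem_erase hv)
      · exact hv ▸ fun h =>
          hnew u (Finset.mem_of_mem_erase hu) (Finset.ne_of_mem_erase hu) (hC _ _ h)
      · exact hSI u (Finset.mem_of_mem_erase hu) v (Finset.mem_of_mem_erase hv) huv

/-- Paths that go right, and up or not at all, from the corner. -/
def RightUp (a b h t : ℕ → ℕ) (v : ℕ) : Prop := a v < h v ∧ b v ≤ t v

/-- Paths that go right and down from the corner. -/
def RightDown (a b h t : ℕ → ℕ) (v : ℕ) : Prop := a v < h v ∧ t v < b v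

/-- Paths that go left from the corner. -/
def Left (a h : ℕ → ℕ) (v : ℕ) : Prop := h v < a v

/-- `v` is selected on a row used by `G`. -/
def RowCand (n k : ℕ) (A G : ℕ → Prop) (a b h t : ℕ → ℕ) (v : ℕ) : Prop :=
  (∃ g < n, G g ∧ a g ≠ h g ∧ b g = b v) ∧
    (Ranked n k A (RightUp a b h t) a b t a v ∨
      Ranked n k A (RightDown a b h t) a b (fun u => b u - t u) a v ∨
      Ranked n k A (Left a h) a b (fun u => a u - h u) h v)

open Classical in
/-- `v` is selected. -/
def Cand (n k : ℕ) (A G : ℕ → Prop) (a b h t : ℕ → ℕ) (v : ℕ) : Prop :=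
  (G v ∧ ((Finset.range n).filter fun u => G u ∧ u < v).card < k) ∨
    (((Finset.range n).filter fun u => G u).card < k ∧
      (RowCand n k A G a b h t v ∨ RowCand n k A G b a t h v))

/-- The shape with a left and a downward arm does not occur, and the corner of a straight path is
its first end. -/
def Normal (a b h t : ℕ → ℕ) (v : ℕ) : Prop :=
  ¬ (h v < a v ∧ t v < b v) ∧ (t v = b v → a v ≤ h v) ∧ (h v = a v → b v ≤ t v)

theorem Normal.transpose {a b h t : ℕ → ℕ} {v : ℕ} (H : Normal a b h t v) : Normal b a t h v :=
  ⟨fun h => H.1 h.symm, H.2.2, H.2.1⟩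

/-! ### The exchange argument and the number of candidates -/

section
variable {n k : ℕ} {A G : ℕ → Prop} {a b h t : ℕ → ℕ} {S : Finset ℕ} {P : ℕ}

/-- In the row of `P`, the corners of the solution lie in columns at most `a P`, and a right arm
reaching beyond `a P` would overlap that of `P`. So an arm going right from column `a P` or later
meets no other member. In the column of `P` itself, the vertical arm of `Q` has the same direction
as that of `P` and is no longer, hence it is contained in it. -/
theorem exists_rowCand_of_right (hA : ∀ v, A v → v < n) (hN : ∀ v, A v → Normal a b h t v)
    (hS : IsSol (Conf a b h t) A k S) (hP : P ∈ S) (hmax : ∀ u ∈ S, a u + b u ≤ a P + b P)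
    (hG : ∃ g < n, G g ∧ a g ≠ h g ∧ b g = b P) (hR : a P < h P) :
    ∃ Q, RowCand n k A G a b h t Q ∧ ∃ S', IsSol (Conf a b h t) A k S' ∧ Q ∈ S' := by
  have hrow : ∀ u ∈ S, u ≠ P → b u = b P → a u ≠ h u → a u ≤ a P ∧ h u ≤ a P := by
    intro u hu hne hb hh
    have h1 := hmax u hu
    have h2 := hS.2.2 u hu P hP hne
    have h3 := hN u (hS.1 u hu)
    have h4 := (not_conf h2).1 hb
    unfold Normal at h3
    unfold Overlap at h4
    omega
  by_cases hU : b P ≤ t P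
  · obtain ⟨Q, h1, h2, h3⟩ := exists_ranked (K := RightUp a b h t) (a := a) (b := b) (d := t)
      (g := a) (used := fun u => b u ≠ t u) (fun _ _ => Conf.symm) hA hS hP ⟨hR, hU⟩
      (fun u v _ _ h _ _ => h.ge) (by
        rintro Q - ⟨hQ1, hQ2⟩ hQb hQg hQ u hu hne hne' hc
        have h1 := hrow u hu hne
        have h2 := hS.2.2 u hu P hP hne
        rcases hc with ⟨hb, hc⟩ | ⟨ha, hc⟩
        · have h3 := h1 (by omega) hc.ne.2
          unfold Overlap at hc
          omega
        · rcases hQ with hQ | hQ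
          · have h3 := (not_conf h2).2 (by omega)
            clear h1 h2
            unfold Overlap at hc h3
            omega
          · exact hQ u hu hne hc.ne.2 ha.symm)
    exact ⟨Q, ⟨by rwa [h2], Or.inl h1⟩, h3⟩
  · obtain ⟨Q, h1, h2, h3⟩ := exists_ranked (K := RightDown a b h t) (a := a) (b := b)
      (d := fun u => b u - t u) (g := a) (used := fun u => b u ≠ t u) (fun _ _ => Conf.symm)
      hA hS hP ⟨hR, not_le.1 hU⟩ (fun u v _ _ h _ _ => h.ge) (by
        rintro Q - ⟨hQ1, hQ2⟩ hQb hQg hQ u hu hne hne' hc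
        have h1 := hrow u hu hne
        have h2 := hS.2.2 u hu P hP hne
        rcases hc with ⟨hb, hc⟩ | ⟨ha, hc⟩
        · have h3 := h1 (by omega) hc.ne.2
          unfold Overlap at hc
          omega
        · rcases hQ with hQ | hQ
          · have h3 := (not_conf h2).2 (by omega)
            clear h1 h2
            unfold Overlap at hc h3
            omega
          · exact hQ u hu hne hc.ne.2 ha.symm)
    exact ⟨Q, ⟨by rwa [h2], Or.inr (Or.inl h1)⟩, h3⟩

theorem exists_rowCand (hA : ∀ v, A v → v < n) (hN : ∀ v, A v → Normal a b h t v)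
    (hS : IsSol (Conf a b h t) A k S) (hP : P ∈ S) (hmax : ∀ u ∈ S, a u + b u ≤ a P + b P)
    (hG : ∃ g < n, G g ∧ a g ≠ h g ∧ b g = b P) (hH : a P ≠ h P) :
    ∃ Q, RowCand n k A G a b h t Q ∧ ∃ S', IsSol (Conf a b h t) A k S' ∧ Q ∈ S' := by
  by_cases hR : a P < h P
  · exact exists_rowCand_of_right hA hN hS hP hmax hG hR
  -- A member with the same corner as `P` and a right arm attains the same maximum and can take the
  -- place of `P`.
  by_cases hex : ∃ u ∈ S, b u = b P ∧ a u = a P ∧ a u < h u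
  · obtain ⟨u, hu, hb, ha, hR'⟩ := hex
    exact exists_rowCand_of_right hA hN hS hu (by rwa [hb, ha]) (by rwa [hb]) hR'
  push Not at hex
  have hL : h P < a P := by omega
  have hNP := hN P (hS.1 P hP)
  have hrow : ∀ u ∈ S, u ≠ P → b u = b P → a u ≠ h u → a u ≤ h P ∧ h u ≤ h P := by
    intro u hu hne hb hh
    have h1 := hmax u hu
    have h2 := hS.2.2 u hu P hP hne
    have h3 := hex u hu hb
    have h4 := (not_conf h2).1 hb
    unfold Overlap at h4
    omega
  -- This is where the missing shape enters. A normal path with a left arm is neither straight nor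
  -- bent downwards, so `P` runs upwards from its corner; by maximality the others in this column
  -- have corners no higher than that of `P`, so they stay below it. Hence upward arms from this
  -- corner are free whatever their length, and `d` may measure the left arm instead.
  have hcol : ∀ u ∈ S, u ≠ P → a u = a P → b u ≠ t u → b u ≤ b P ∧ t u ≤ b P := by
    intro u hu hne ha hh
    have h1 := hmax u hu
    have h2 := hS.2.2 u hu P hP hne
    have h4 := (not_conf h2).2 ha
    unfold Normal at hNP
    unfold Overlap at h4
    omega
  obtain ⟨Q, h1, h2, h3⟩ := exists_ranked (K := Left a h) (a := a) (b := b)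
    (d := fun u => a u - h u) (g := h) (used := fun u => b u ≠ t u) (fun _ _ => Conf.symm)
    hA hS hP hL (fun u v hu hv _ _ _ => by unfold Left at hu hv; omega) (by
      rintro Q hQA hQ1 hQb hQg hQ u hu hne hne' hc
      have h1 := hrow u hu hne
      have h2 := hcol u hu hne
      have h3 := hN Q hQA
      unfold Left at hQ1
      unfold Normal at h3
      rcases hc with ⟨hb, hc⟩ | ⟨ha, hc⟩
      · have h4 := h1 (by omega) hc.ne.2
        unfold Overlap at hc
        omega
      · rcases hQ with hQ | hQ
        · have h4 := h2 (by omega) hc.ne.2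
          unfold Overlap at hc
          omega
        · exact hQ u hu hne hc.ne.2 ha.symm)
  exact ⟨Q, ⟨by rwa [h2], Or.inr (Or.inr h1)⟩, h3⟩

/-- If `G` is large, its first member extends to `k` members of `G`, which are independent since
they share no line. If `G` is small, the member of `S` with the largest corner sum is in `G` or
shares a line with `G`, and the exchange applies along that line. -/
theorem exists_cand (hA : ∀ v, A v → v < n) (hN : ∀ v, A v → Normal a b h t v)
    (hGA : ∀ v, G v → A v) (hGI : ∀ u v, G u → G v → u ≠ v → ¬ Share a b h t u v)
    (hGmax : ∀ v, A v → ¬ G v → ∃ g, G g ∧ Share a b h t g v) (hk : 0 < k)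
    (hS : IsSol (Conf a b h t) A k S) :
    ∃ v, Cand n k A G a b h t v ∧ ∃ S', IsSol (Conf a b h t) A k S' ∧ v ∈ S' := by
  classical
  by_cases hcard : ((Finset.range n).filter fun u => G u).card < k
  · have hSne : S.Nonempty := by rw [← Finset.card_pos, hS.2.1]; exact hk
    obtain ⟨P, hP, hmax⟩ := S.exists_max_image (fun u => a u + b u) hSne
    by_cases hPG : G P
    · refine ⟨P, Or.inl ⟨hPG, lt_of_le_of_lt (Finset.card_le_card ?_) hcard⟩, S, hS, hP⟩
      intro u hu
      simp only [Finset.mem_filter] at hu ⊢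
      exact ⟨hu.1, hu.2.1⟩
    · obtain ⟨g, hg, hsh⟩ := hGmax P (hS.1 P hP) hPG
      have hgn := hA g (hGA g hg)
      rcases hsh with ⟨h1, h2, h3⟩ | ⟨h1, h2, h3⟩
      · obtain ⟨Q, hQ, hQ'⟩ := exists_rowCand (G := G) hA hN hS hP hmax ⟨g, hgn, hg, h2, h1⟩ h3
        exact ⟨Q, Or.inr ⟨hcard, Or.inl hQ⟩, hQ'⟩
      -- A shared column becomes a shared row when the axes are swapped; normality and the corner
      -- sum are symmetric.
      · rw [← conf_transpose] at hS ⊢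
        obtain ⟨Q, hQ, hQ'⟩ := exists_rowCand (G := G) hA (fun v hv => (hN v hv).transpose) hS hP
          (fun u hu => by have := hmax u hu; omega) ⟨g, hgn, hg, h2, h1⟩ h3
        exact ⟨Q, Or.inr ⟨hcard, Or.inr hQ⟩, hQ'⟩
  · let F := (Finset.range n).filter fun u => G u
    have hne : F.Nonempty := by rw [← Finset.card_pos]; simp only [F]; omega
    obtain ⟨v, hv, hmin⟩ := F.exists_min_image id hne
    obtain ⟨S', hvS, hSF, hSk⟩ := Finset.exists_subsuperset_card_eq
      (Finset.singleton_subset_iff.2 hv) (by simpa using Nat.succ_le_of_lt hk) (not_lt.1 hcard)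
    have hFG : ∀ u ∈ F, G u := fun u hu => (Finset.mem_filter.1 hu).2
    refine ⟨v, Or.inl ⟨hFG v hv, ?_⟩, S', ⟨fun u hu => hGA u (hFG u (hSF hu)), hSk,
      fun u hu w hw huw hc => hGI u w (hFG u (hSF hu)) (hFG w (hSF hw)) huw hc.share⟩,
      Finset.singleton_subset_iff.1 hvS⟩
    rw [Finset.filter_eq_empty_iff.2, Finset.card_empty]
    · exact hk
    · rintro u hu ⟨hu1, hu2⟩
      have := hmin u (Finset.mem_filter.2 ⟨hu, hu1⟩)
      simp only [id] at this
      omega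

/-! ### Counting the candidates -/

open Classical in
theorem card_ranked_le (K : ℕ → Prop) (d g : ℕ → ℕ) (β : ℕ) :
    ((Finset.range n).filter fun v => Ranked n k A K a b d g v ∧ b v = β).card ≤ k := by
  refine le_trans (Finset.card_le_card ?_) (card_filter_rank_lt
    ((Finset.range n).filter fun v => Rep n A K a b d v ∧ b v = β) (Beats g) k
    (fun _ _ => beats_irrefl) (fun _ _ _ _ _ _ => Beats.trans) (fun _ _ _ _ => beats_total))
  intro v hv
  simp only [Finset.mem_filter, Finset.filter_filter] at hv ⊢
  obtain ⟨hv, ⟨h1, h2⟩, h3⟩ := hv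
  refine ⟨hv, ⟨h1, h3⟩, ?_⟩
  subst h3
  exact h2

open Classical in
theorem card_rowCand_le :
    ((Finset.range n).filter fun v => RowCand n k A G a b h t v).card ≤
      ((Finset.range n).filter fun v => G v).card * (3 * k) := by
  refine le_trans (Finset.card_le_card (t := ((Finset.range n).filter fun v => G v).biUnion fun g =>
    ((Finset.range n).filter fun v =>
        Ranked n k A (RightUp a b h t) a b t a v ∧ b v = b g) ∪
      (((Finset.range n).filter fun v =>
        Ranked n k A (RightDown a b h t) a b (fun u => b u - t u) a v ∧ b v = b g) ∪
      ((Finset.range n).filter fun v =>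
        Ranked n k A (Left a h) a b (fun u => a u - h u) h v ∧ b v = b g))) ?_)
    (Finset.card_biUnion_le_card_mul _ _ _ fun g _ => ?_)
  · intro v hv
    simp only [Finset.mem_filter, Finset.mem_biUnion, Finset.mem_union, Finset.mem_range] at hv ⊢
    obtain ⟨hv, ⟨g, hg, hG, -, hb⟩, hr⟩ := hv
    refine ⟨g, ⟨hg, hG⟩, ?_⟩
    rcases hr with hr | hr | hr
    · exact Or.inl ⟨hv, hr, hb.symm⟩
    · exact Or.inr (Or.inl ⟨hv, hr, hb.symm⟩)
    · exact Or.inr (Or.inr ⟨hv, hr, hb.symm⟩)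
  · refine (Finset.card_union_le _ _).trans ?_
    have h0 := Finset.card_union_le ((Finset.range n).filter fun v =>
        Ranked n k A (RightDown a b h t) a b (fun u => b u - t u) a v ∧ b v = b g)
      ((Finset.range n).filter fun v =>
        Ranked n k A (Left a h) a b (fun u => a u - h u) h v ∧ b v = b g)
    have h1 := card_ranked_le (n := n) (k := k) (A := A) (a := a) (b := b) (RightUp a b h t) t a (b g)
    have h2 := card_ranked_le (n := n) (k := k) (A := A) (a := a) (b := b) (RightDown a b h t)
      (fun u => b u - t u) a (b g)
    have h3 := card_ranked_le (n := n) (k := k) (A := A) (a := a) (b := b) (Left a h)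
      (fun u => a u - h u) h (b g)
    omega

open Classical in
theorem card_cand_le :
    ((Finset.range n).filter fun v => Cand n k A G a b h t v).card ≤ 6 * k ^ 2 := by
  have h1 : ((Finset.range n).filter fun v =>
      G v ∧ ((Finset.range n).filter fun u => G u ∧ u < v).card < k).card ≤ k := by
    refine le_trans (Finset.card_le_card ?_) (card_filter_rank_lt
      ((Finset.range n).filter fun v => G v) (· < ·) k (fun _ _ => lt_irrefl _)
      (fun _ _ _ _ _ _ => lt_trans) (fun _ _ _ _ => Nat.lt_or_gt_of_ne))
    intro v hv
    simp only [Finset.mem_filter, Finset.filter_filter] at hv ⊢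
    exact hv
  by_cases hcard : ((Finset.range n).filter fun u => G u).card < k
  · refine le_trans (Finset.card_le_card (t := ((Finset.range n).filter fun v =>
      G v ∧ ((Finset.range n).filter fun u => G u ∧ u < v).card < k) ∪
      (((Finset.range n).filter fun v => RowCand n k A G a b h t v) ∪
      ((Finset.range n).filter fun v => RowCand n k A G b a t h v))) ?_) ?_
    · intro v hv
      simp only [Finset.mem_filter, Finset.mem_union] at hv ⊢
      unfold Cand at hv
      tauto
    · refine (Finset.card_union_le _ _).trans ?_
      have h0 := Finset.card_union_le
        ((Finset.range n).filter fun v => RowCand n k A G a b h t v)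
        ((Finset.range n).filter fun v => RowCand n k A G b a t h v)
      have h2 := card_rowCand_le (n := n) (k := k) (A := A) (G := G) (a := a) (b := b) (h := h)
        (t := t)
      have h3 := card_rowCand_le (n := n) (k := k) (A := A) (G := G) (a := b) (b := a) (h := t)
        (t := h)
      -- In this case `|G| ≤ k - 1`, so the total is at most `k + 2 * (k - 1) * 3 * k`. The slack
      -- from `|G| < k` absorbs the summand `k`.
      obtain ⟨j, rfl⟩ : ∃ j, k = j + 1 := ⟨k - 1, by omega⟩
      have h4 := Nat.mul_le_mul_right (3 * (j + 1)) (Nat.lt_succ_iff.1 hcard)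
      nlinarith
  · refine le_trans (Finset.card_le_card ?_) (h1.trans (by nlinarith))
    intro v hv
    simp only [Finset.mem_filter] at hv ⊢
    unfold Cand at hv
    tauto

end

/-! ## Normalized coordinates, and their computation -/

/-- The sum of all coordinates. -/
def Mem.total (m : Mem) : ℕ := ∑ u ∈ Finset.range m.size, (m 0 u + m 1 u + (m 2 u + m 3 u))

/-- Some path goes left and down from its corner. -/
def HasLeftDown (m : Mem) : Prop := ∃ u < m.size, m 2 u < m 0 u ∧ m 3 u < m 1 u

/-- Some path goes left and up from its corner. -/
def HasLeftUp (m : Mem) : Prop := ∃ u < m.size, m 2 u < m 0 u ∧ m 1 u < m 3 u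

/-- Some path goes right and down from its corner. -/
def HasRightDown (m : Mem) : Prop := ∃ u < m.size, m 0 u < m 2 u ∧ m 3 u < m 1 u

/-- Some path goes right and up from its corner. -/
def HasRightUp (m : Mem) : Prop := ∃ u < m.size, m 0 u < m 2 u ∧ m 1 u < m 3 u

open Classical in
/-- Column `m j v`, after a reflection that is applied if two shapes with a left arm occur. -/
noncomputable def colOf (j : ℕ) (m : Mem) (v : ℕ) : ℕ :=
  if HasLeftDown m ∧ HasLeftUp m then m.total - m j v else m j v

open Classical in
/-- Row `m j v`, after a reflection if one is needed. -/
noncomputable def rowOf (j : ℕ) (m : Mem) (v : ℕ) : ℕ :=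
  if HasLeftDown m ∧ (¬ HasLeftUp m ∨ HasRightDown m) then m.total - m j v else m j v

/-- The column of the corner. -/
noncomputable def nA (m : Mem) (v : ℕ) : ℕ :=
  if rowOf 1 m v = rowOf 3 m v then min (colOf 0 m v) (colOf 2 m v) else colOf 0 m v

/-- The row of the corner. -/
noncomputable def nB (m : Mem) (v : ℕ) : ℕ :=
  if colOf 0 m v = colOf 2 m v then min (rowOf 1 m v) (rowOf 3 m v) else rowOf 1 m v

/-- The column of the end of the horizontal arm. -/
noncomputable def nH (m : Mem) (v : ℕ) : ℕ :=
  if rowOf 1 m v = rowOf 3 m v then max (colOf 0 m v) (colOf 2 m v) else colOf 2 m v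

/-- The row of the end of the vertical arm. -/
noncomputable def nT (m : Mem) (v : ℕ) : ℕ :=
  if colOf 0 m v = colOf 2 m v then max (rowOf 1 m v) (rowOf 3 m v) else rowOf 3 m v

theorem le_total {m : Mem} {v : ℕ} (hv : v < m.size) :
    m 0 v + m 1 v + (m 2 v + m 3 v) ≤ m.total :=
  Finset.single_le_sum (f := fun u => m 0 u + m 1 u + (m 2 u + m 3 u)) (fun _ _ => Nat.zero_le _)
    (Finset.mem_range.2 hv)

/-- The reflections move the missing shape to left-down: none if left-down is missing, rows if
left-up is missing, columns if right-down is missing, both if right-up is missing. Reflecting at the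
sum of all coordinates avoids truncation, as each coordinate is at most that sum. -/
theorem normal_coords {m : Mem}
    (h : ¬ HasLeftDown m ∨ ¬ HasLeftUp m ∨ ¬ HasRightDown m ∨ ¬ HasRightUp m) {v : ℕ}
    (hv : v < m.size) : Normal (nA m) (nB m) (nH m) (nT m) v := by
  have hle := le_total hv
  have key : ¬ (colOf 2 m v < colOf 0 m v ∧ rowOf 3 m v < rowOf 1 m v) := by
    by_cases h1 : HasLeftDown m
    · by_cases h2 : HasLeftUp m
      · by_cases h3 : HasRightDown m
        · have h4 : ¬ HasRightUp m := by tauto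
          have h5 : ¬ (m 0 v < m 2 v ∧ m 1 v < m 3 v) := fun h5 => h4 ⟨v, hv, h5⟩
          simp only [colOf, rowOf, h1, h2, h3, if_true, and_true, or_true]
          omega
        · have h5 : ¬ (m 0 v < m 2 v ∧ m 3 v < m 1 v) := fun h5 => h3 ⟨v, hv, h5⟩
          simp only [colOf, rowOf, h1, h2, h3, if_true, and_true, or_false, not_true, and_false,
            if_false]
          omega
      · have h5 : ¬ (m 2 v < m 0 v ∧ m 1 v < m 3 v) := fun h5 => h2 ⟨v, hv, h5⟩
        simp only [colOf, rowOf, h1, h2, if_true, true_and, and_false, if_false, not_false_iff,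
          true_or]
        omega
    · have h5 : ¬ (m 2 v < m 0 v ∧ m 3 v < m 1 v) := fun h5 => h1 ⟨v, hv, h5⟩
      simpa only [colOf, rowOf, h1, false_and, if_false] using h5
  refine ⟨?_, ?_, ?_⟩ <;> unfold nA nB nH nT <;> split_ifs <;> omega

theorem conf_coords {m : Mem} {u v : ℕ} (hu : u < m.size) (hv : v < m.size) :
    Conf (nA m) (nB m) (nH m) (nT m) u v ↔ Conf (m 0) (m 1) (m 2) (m 3) u v := by
  have hleu := le_total hu
  have hlev := le_total hv
  have e1 : ∀ j ∈ [1, 3], ∀ i ∈ [1, 3], rowOf j m u = rowOf i m v ↔ m j u = m i v := by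
    simp only [List.mem_cons, List.not_mem_nil, or_false]
    rintro j (rfl | rfl) i (rfl | rfl) <;> unfold rowOf <;> split_ifs <;> omega
  have e2 : ∀ j ∈ [0, 2], ∀ i ∈ [0, 2], colOf j m u = colOf i m v ↔ m j u = m i v := by
    simp only [List.mem_cons, List.not_mem_nil, or_false]
    rintro j (rfl | rfl) i (rfl | rfl) <;> unfold colOf <;> split_ifs <;> omega
  have e3 : Overlap (colOf 0 m u) (colOf 2 m u) (colOf 0 m v) (colOf 2 m v) ↔
      Overlap (m 0 u) (m 2 u) (m 0 v) (m 2 v) := by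
    unfold colOf; split_ifs
    · exact overlap_reflect (by omega) (by omega) (by omega) (by omega)
    · rfl
  have e4 : Overlap (rowOf 1 m u) (rowOf 3 m u) (rowOf 1 m v) (rowOf 3 m v) ↔
      Overlap (m 1 u) (m 3 u) (m 1 v) (m 3 v) := by
    unfold rowOf; split_ifs
    · exact overlap_reflect (by omega) (by omega) (by omega) (by omega)
    · rfl
  have e5 : Overlap (nA m u) (nH m u) (nA m v) (nH m v) ↔
      Overlap (colOf 0 m u) (colOf 2 m u) (colOf 0 m v) (colOf 2 m v) := by
    unfold nA nH Overlap; split_ifs <;> simp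
  have e6 : Overlap (nB m u) (nT m u) (nB m v) (nT m v) ↔
      Overlap (rowOf 1 m u) (rowOf 3 m u) (rowOf 1 m v) (rowOf 3 m v) := by
    unfold nB nT Overlap; split_ifs <;> simp
  unfold Conf
  rw [e5, e6]
  refine or_congr ?_ ?_
  -- Paths that overlap horizontally have nondegenerate horizontal arms, so their rows were not
  -- altered by moving the corners of vertical paths.
  · rw [e3, and_congr_left_iff, ← e1 1 (by simp) 1 (by simp), ← e3]
    intro h
    have := h.ne
    simp only [nB, if_neg this.1, if_neg this.2]
  · rw [e4, and_congr_left_iff, ← e2 0 (by simp) 0 (by simp), ← e4]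
    intro h
    have := h.ne
    simp only [nA, if_neg this.1, if_neg this.2]

/-- The memories agree on the coordinates of the paths. -/
structure SameInput (m m' : Mem) : Prop where
  size : m'.size = m.size
  arr : ∀ a < 4, m' a = m a

theorem SameInput.trans {m m' m'' : Mem} (h : SameInput m m') (h' : SameInput m' m'') :
    SameInput m m'' :=
  ⟨h'.size.trans h.size, fun a ha => (h'.arr a ha).trans (h.arr a ha)⟩

theorem SameInput.coords {m m' : Mem} (h : SameInput m m') :
    nA m' = nA m ∧ nB m' = nB m ∧ nH m' = nH m ∧ nT m' = nT m := by
  have h0 := h.arr 0 (by norm_num)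
  have h1 := h.arr 1 (by norm_num)
  have h2 := h.arr 2 (by norm_num)
  have h3 := h.arr 3 (by norm_num)
  have hL : HasLeftDown m' ↔ HasLeftDown m := by simp only [HasLeftDown, h0, h1, h2, h3, h.size]
  have hU : HasLeftUp m' ↔ HasLeftUp m := by simp only [HasLeftUp, h0, h1, h2, h3, h.size]
  have hR : HasRightDown m' ↔ HasRightDown m := by simp only [HasRightDown, h0, h1, h2, h3, h.size]
  have ht : m'.total = m.total := by simp only [Mem.total, h0, h1, h2, h3, h.size]
  have hc : ∀ j < 4, colOf j m' = colOf j m := fun j hj => by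
    ext v
    unfold colOf
    rw [ht, h.arr j hj]
    split_ifs <;> tauto
  have hr : ∀ j < 4, rowOf j m' = rowOf j m := fun j hj => by
    ext v
    unfold rowOf
    rw [ht, h.arr j hj]
    split_ifs <;> tauto
  refine ⟨?_, ?_, ?_, ?_⟩ <;> ext v <;>
    simp only [nA, nB, nH, nT, hc 0 (by norm_num), hc 2 (by norm_num), hr 1 (by norm_num),
      hr 3 (by norm_num)]

/-- A function of the memory and an argument is computable in polynomial time. -/
def EvFn (f : Mem → ℕ → ℕ) : Prop :=
  ∀ {E : Type} [Ctx E] {x : E → Mem → ℕ}, Ev x → Ev fun e m => f m (x e m)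

/-- A predicate of the memory and an argument is decidable in polynomial time. -/
def PredFn (P : Mem → ℕ → Prop) : Prop :=
  ∀ {E : Type} [Ctx E] {x : E → Mem → ℕ}, Ev x → Pred fun e m => P m (x e m)

theorem EvFn.sub {f g : Mem → ℕ → ℕ} (hf : EvFn f) (hg : EvFn g) : EvFn fun m v => f m v - g m v :=
  fun hx => .sub (hf hx) (hg hx)

/-! ### Normalized coordinates are computable in polynomial time -/

section
variable {E : Type} [Ctx E]

theorem Ev.total : Ev fun (_ : E) m => m.total :=
  .sum (f := fun _ i m => m 0 i + m 1 i + (m 2 i + m 3 i))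
    (.add (.add (.arr 0 .var) (.arr 1 .var)) (.add (.arr 2 .var) (.arr 3 .var)))

theorem Pred.hasLeftDown : Pred fun (_ : E) m => HasLeftDown m :=
  .ex (P := fun _ u m => m 2 u < m 0 u ∧ m 3 u < m 1 u)
    (.and (.lt (.arr 2 .var) (.arr 0 .var)) (.lt (.arr 3 .var) (.arr 1 .var)))

theorem Pred.hasLeftUp : Pred fun (_ : E) m => HasLeftUp m :=
  .ex (P := fun _ u m => m 2 u < m 0 u ∧ m 1 u < m 3 u)
    (.and (.lt (.arr 2 .var) (.arr 0 .var)) (.lt (.arr 1 .var) (.arr 3 .var)))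

theorem Pred.hasRightDown : Pred fun (_ : E) m => HasRightDown m :=
  .ex (P := fun _ u m => m 0 u < m 2 u ∧ m 3 u < m 1 u)
    (.and (.lt (.arr 0 .var) (.arr 2 .var)) (.lt (.arr 3 .var) (.arr 1 .var)))

end

theorem EvFn.colOf (j : ℕ) : EvFn (colOf j) := fun hx =>
  .ite (.and .hasLeftDown .hasLeftUp) (.sub .total (.arr j hx)) (.arr j hx)

theorem EvFn.rowOf (j : ℕ) : EvFn (rowOf j) := fun hx =>
  .ite (.and .hasLeftDown (.or (.not .hasLeftUp) .hasRightDown)) (.sub .total (.arr j hx))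
    (.arr j hx)

theorem EvFn.nA : EvFn nA := fun hx =>
  .ite (.eq (rowOf 1 hx) (rowOf 3 hx)) (.min (colOf 0 hx) (colOf 2 hx)) (colOf 0 hx)

theorem EvFn.nB : EvFn nB := fun hx =>
  .ite (.eq (colOf 0 hx) (colOf 2 hx)) (.min (rowOf 1 hx) (rowOf 3 hx)) (rowOf 1 hx)

theorem EvFn.nH : EvFn nH := fun hx =>
  .ite (.eq (rowOf 1 hx) (rowOf 3 hx)) (.max (colOf 0 hx) (colOf 2 hx)) (colOf 2 hx)

theorem EvFn.nT : EvFn nT := fun hx =>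
  .ite (.eq (colOf 0 hx) (colOf 2 hx)) (.max (rowOf 1 hx) (rowOf 3 hx)) (rowOf 3 hx)

/-! ### The candidate predicate is decidable in polynomial time -/

section
variable {A G K : Mem → ℕ → Prop} {a b h t d g : Mem → ℕ → ℕ} {k : Mem → ℕ}

theorem Pred.overlap {E : Type} [Ctx E] {x y x' y' : E → Mem → ℕ} (hx : Ev x) (hy : Ev y)
    (hx' : Ev x') (hy' : Ev y') : Pred fun e m => Overlap (x e m) (y e m) (x' e m) (y' e m) :=
  .lt (.max (.min hx hy) (.min hx' hy')) (.min (.max hx hy) (.max hx' hy'))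

theorem Pred.conf (ha : EvFn a) (hb : EvFn b) (hh : EvFn h) (ht : EvFn t) {E : Type} [Ctx E]
    {x y : E → Mem → ℕ} (hx : Ev x) (hy : Ev y) :
    Pred fun e m => Conf (a m) (b m) (h m) (t m) (x e m) (y e m) :=
  .or (.and (.eq (hb hx) (hb hy)) (.overlap (ha hx) (hh hx) (ha hy) (hh hy)))
    (.and (.eq (ha hx) (ha hy)) (.overlap (hb hx) (ht hx) (hb hy) (ht hy)))

theorem Pred.share (ha : EvFn a) (hb : EvFn b) (hh : EvFn h) (ht : EvFn t) {E : Type} [Ctx E]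
    {x y : E → Mem → ℕ} (hx : Ev x) (hy : Ev y) :
    Pred fun e m => Share (a m) (b m) (h m) (t m) (x e m) (y e m) :=
  .or (.and (.eq (hb hx) (hb hy)) (.and (.not (.eq (ha hx) (hh hx))) (.not (.eq (ha hy) (hh hy)))))
    (.and (.eq (ha hx) (ha hy)) (.and (.not (.eq (hb hx) (ht hx))) (.not (.eq (hb hy) (ht hy)))))

theorem PredFn.rep (hA : PredFn A) (hK : PredFn K) (ha : EvFn a) (hb : EvFn b) (hd : EvFn d) :
    PredFn fun m v => Rep m.size (A m) (K m) (a m) (b m) (d m) v := fun {_} _ {x} hx =>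
  .and (.and (hA hx) (hK hx)) (.all (P := fun e u m => A m u ∧ K m u →
      a m u = a m (x e m) ∧ b m u = b m (x e m) →
        ¬ (d m u < d m (x e m) ∨ d m u = d m (x e m) ∧ u < x e m))
    (.imp (.and (hA .var) (hK .var)) (.imp (.and (.eq (ha .var) (ha hx.weak))
      (.eq (hb .var) (hb hx.weak))) (.not (.or (.lt (hd .var) (hd hx.weak))
      (.and (.eq (hd .var) (hd hx.weak)) (.lt .var hx.weak)))))))

theorem PredFn.ranked (hk : EvFn fun m _ => k m) (hA : PredFn A) (hK : PredFn K) (ha : EvFn a)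
    (hb : EvFn b) (hd : EvFn d) (hg : EvFn g) :
    PredFn fun m v => Ranked m.size (k m) (A m) (K m) (a m) (b m) (d m) (g m) v :=
  fun {_} _ {x} hx =>
  .and (rep hA hK ha hb hd hx) (.lt (.card (P := fun e u m =>
      (Rep m.size (A m) (K m) (a m) (b m) (d m) u ∧ b m u = b m (x e m)) ∧ Beats (g m) u (x e m))
    (.and (.and (rep hA hK ha hb hd .var) (.eq (hb .var) (hb hx.weak)))
      (.or (.lt (hg hx.weak) (hg .var)) (.and (.eq (hg .var) (hg hx.weak)) (.lt .var hx.weak)))))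
    (hk hx))

theorem PredFn.rowCand (hk : EvFn fun m _ => k m) (hA : PredFn A) (hG : PredFn G) (ha : EvFn a)
    (hb : EvFn b) (hh : EvFn h) (ht : EvFn t) :
    PredFn fun m v => RowCand m.size (k m) (A m) (G m) (a m) (b m) (h m) (t m) v :=
  fun {_} _ {x} hx =>
  .and (.ex (P := fun e g m => G m g ∧ a m g ≠ h m g ∧ b m g = b m (x e m))
      (.and (hG .var) (.and (.not (.eq (ha .var) (hh .var))) (.eq (hb .var) (hb hx.weak)))))
    (.or (ranked hk hA (K := fun m => RightUp (a m) (b m) (h m) (t m))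
        (fun hy => .and (.lt (ha hy) (hh hy)) (.le (hb hy) (ht hy))) ha hb ht ha hx)
      (.or (ranked hk hA (K := fun m => RightDown (a m) (b m) (h m) (t m))
        (d := fun m u => b m u - t m u)
        (fun hy => .and (.lt (ha hy) (hh hy)) (.lt (ht hy) (hb hy))) ha hb (hb.sub ht) ha hx)
      (ranked hk hA (K := fun m => Left (a m) (h m)) (d := fun m u => a m u - h m u)
        (fun hy => .lt (hh hy) (ha hy)) ha hb (ha.sub hh) hh hx)))

theorem PredFn.cand (hk : EvFn fun m _ => k m) (hA : PredFn A) (hG : PredFn G) (ha : EvFn a)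
    (hb : EvFn b) (hh : EvFn h) (ht : EvFn t) :
    PredFn fun m v => Cand m.size (k m) (A m) (G m) (a m) (b m) (h m) (t m) v :=
  fun {_} _ {x} hx =>
  .or (.and (hG hx) (.lt (.card (P := fun e u m => G m u ∧ u < x e m)
      (.and (hG .var) (.lt .var hx.weak))) (hk hx)))
    (.and (.lt (.card (P := fun _ u m => G m u) (hG .var)) (hk hx))
      (.or (rowCand hk hA hG ha hb hh ht hx) (rowCand hk hA hG hb ha ht hh hx)))

end

/-! ## The selection of candidates as a program -/

theorem Mem.set_of_ne (m : Mem) {a c : ℕ} (i v : ℕ) (h : a ≠ c) : m.set c i v a = m a :=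
  Function.update_of_ne h _ _

theorem Mem.set_same (m : Mem) (c i v : ℕ) : m.set c i v c i = v := by simp [Mem.set]

theorem Mem.set_same_of_ne (m : Mem) (c v : ℕ) {i j : ℕ} (h : j ≠ i) :
    m.set c i v c j = m c j := by simp [Mem.set, h]

theorem ind_eq_one {p : Prop} : ind p = 1 ↔ p := by
  by_cases h : p <;> simp [ind_def, h]

theorem ind_le_one (p : Prop) : ind p ≤ 1 := by
  by_cases h : p <;> simp [ind_def, h]

theorem ind_congr {p q : Prop} (h : p ↔ q) : ind p = ind q := by rw [propext h]

/-- Filling array `c` from left to right by values that only depend on the other arrays and on the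
entries filled before. -/
theorem iter_set {c : ℕ} {val : ℕ → Mem → ℕ} (hval : ∀ i (m m' : Mem), (∀ a ≠ c, m' a = m a) →
    (∀ u < i, m' c u = m c u) → val i m' = val i m) (m : Mem) (N : ℕ) :
    (∀ a ≠ c, iter (fun i m => m.set c i (val i m)) N m a = m a) ∧
      ∀ i < N, iter (fun i m => m.set c i (val i m)) N m c i =
        val i (iter (fun i m => m.set c i (val i m)) N m) := by
  set M : ℕ → Mem := fun j => iter (fun i m => m.set c i (val i m)) j m with hM
  have hstep : ∀ j, M (j + 1) = (M j).set c j (val j (M j)) := fun j => iter_succ _ _ _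
  have hoff : ∀ j, ∀ a ≠ c, M j a = m a := by
    intro j a ha
    induction j with
    | zero => rfl
    | succ j ih => rw [hstep, Mem.set_of_ne _ _ _ ha, ih]
  have hstable : ∀ i j, i ≤ j → ∀ u < i, M j c u = M i c u := by
    intro i j hij u hu
    induction j, hij using Nat.le_induction with
    | base => rfl
    | succ j hj ih => rw [hstep, Mem.set_same_of_ne _ _ _ (by omega), ih]
  refine ⟨hoff N, fun i hi => ?_⟩
  change M N c i = val i (M N)
  rw [hstable (i + 1) N hi i (by omega), hstep, Mem.set_same]
  refine (hval i _ _ (fun a ha => ?_) (hstable i N hi.le)).symm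
  rw [hoff _ a ha, hoff _ a ha]

/-- Filling a part of array `c` by values that only depend on the other arrays. -/
theorem iter_map {c : ℕ} {off : Mem → ℕ} {val : ℕ → Mem → ℕ}
    (hoff : ∀ m m' : Mem, (∀ a ≠ c, m' a = m a) → off m' = off m)
    (hval : ∀ i (m m' : Mem), (∀ a ≠ c, m' a = m a) → val i m' = val i m) (m : Mem) (N : ℕ) :
    (∀ a ≠ c, iter (fun i m => m.set c (off m + i) (val i m)) N m a = m a) ∧
      (∀ i < N, iter (fun i m => m.set c (off m + i) (val i m)) N m c (off m + i) = val i m) ∧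
      ∀ j, j < off m ∨ off m + N ≤ j →
        iter (fun i m => m.set c (off m + i) (val i m)) N m c j = m c j := by
  induction N with
  | zero => exact ⟨fun _ _ => rfl, by omega, fun _ _ => rfl⟩
  | succ N ih =>
    obtain ⟨h1, h2, h3⟩ := ih
    rw [iter_succ]
    generalize iter (fun i m => m.set c (off m + i) (val i m)) N m = M at h1 h2 h3
    rw [hoff m M h1, hval N m M h1]
    refine ⟨fun a ha => by rw [Mem.set_of_ne _ _ _ ha, h1 a ha], fun i hi => ?_, fun j hj => ?_⟩
    · rcases (Nat.lt_succ_iff.1 hi).lt_or_eq with hi | rfl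
      · rw [Mem.set_same_of_ne _ _ _ (by omega), h2 i hi]
      · rw [Mem.set_same]
    · rw [Mem.set_same_of_ne _ _ _ (by omega), h3 j (by omega)]

/-- Adjacency in normalized coordinates. -/
def NConf (m : Mem) : ℕ → ℕ → Prop := Conf (nA m) (nB m) (nH m) (nT m)

/-- Line sharing in normalized coordinates. -/
def NShare (m : Mem) : ℕ → ℕ → Prop := Share (nA m) (nB m) (nH m) (nT m)

/-- The vertices marked in array `a`. -/
def Marked (a : ℕ) (m : Mem) (v : ℕ) : Prop := v < m.size ∧ m a v = 1

/-- Mark in array `6` a maximal set of alive vertices that use pairwise different lines. -/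
noncomputable def greedyLoop (m : Mem) : Mem :=
  iter (fun v m => m.set 6 v (ind (Marked 5 m v ∧
    ¬ ∃ u < m.size, (u < v ∧ m 6 u = 1) ∧ NShare m u v))) m.size m

/-- Mark the candidates in array `7`. -/
noncomputable def candLoop (m : Mem) : Mem :=
  iter (fun v m => m.set 7 v (ind (Cand m.size (m 4 1) (Marked 5 m) (Marked 6 m)
    (nA m) (nB m) (nH m) (nT m) v))) m.size m

/-- Mark in array `7` candidates among the vertices marked in array `5`. -/
noncomputable def select (m : Mem) : Mem := candLoop (greedyLoop m)

theorem sameInput_of_arr {m m' : Mem} (h : ∀ a ≤ 4, m' a = m a) : SameInput m m' :=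
  ⟨by unfold Mem.size; rw [h 4 le_rfl], fun a ha => h a ha.le⟩

theorem SameInput.nconf {m m' : Mem} (h : SameInput m m') : NConf m' = NConf m := by
  unfold NConf; rw [h.coords.1, h.coords.2.1, h.coords.2.2.1, h.coords.2.2.2]

theorem SameInput.nshare {m m' : Mem} (h : SameInput m m') : NShare m' = NShare m := by
  unfold NShare; rw [h.coords.1, h.coords.2.1, h.coords.2.2.1, h.coords.2.2.2]

/-- An entry of array `6` depends only on earlier entries, which are never changed again, so the
final array itself satisfies the greedy recursion. Both the independence and the maximality of the
greedy set are read off from it. -/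
theorem greedyLoop_spec (m : Mem) : (∀ a ≠ 6, greedyLoop m a = m a) ∧
    ∀ v < m.size, greedyLoop m 6 v = 1 ↔
      Marked 5 m v ∧ ¬ ∃ u < m.size, (u < v ∧ greedyLoop m 6 u = 1) ∧ NShare m u v := by
  obtain ⟨h1, h2⟩ := iter_set (c := 6) (val := fun v m => ind (Marked 5 m v ∧
    ¬ ∃ u < m.size, (u < v ∧ m 6 u = 1) ∧ NShare m u v)) (by
      intro i m m' h h'
      have hs : SameInput m m' := sameInput_of_arr fun a ha => h a (by omega)
      apply ind_congr
      unfold Marked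
      rw [hs.size, h 5 (by norm_num), hs.nshare]
      refine and_congr_right fun _ => not_congr (exists_congr fun u => and_congr_right fun _ =>
        and_congr_left fun _ => and_congr_right fun hu => ?_)
      rw [h' u hu]) m m.size
  change ∀ a ≠ 6, greedyLoop m a = m a at h1
  refine ⟨h1, fun v hv => ?_⟩
  have hs : SameInput m (greedyLoop m) := sameInput_of_arr fun a ha => h1 a (by omega)
  have := h2 v hv
  change greedyLoop m 6 v = ind (Marked 5 (greedyLoop m) v ∧ ¬ ∃ u < (greedyLoop m).size,
    (u < v ∧ greedyLoop m 6 u = 1) ∧ NShare (greedyLoop m) u v) at this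
  rw [this, ind_eq_one]
  unfold Marked
  rw [hs.size, h1 5 (by norm_num), hs.nshare]

theorem select_off (m : Mem) : ∀ a ≠ 6, a ≠ 7 → select m a = m a := by
  intro a h6 h7
  have h2 : select m a = greedyLoop m a := (iter_set (c := 7) (val := fun v m =>
    ind (Cand m.size (m 4 1) (Marked 5 m) (Marked 6 m) (nA m) (nB m) (nH m) (nT m) v)) (by
      intro i m m' h _
      have hs : SameInput m m' := sameInput_of_arr fun a ha => h a (by omega)
      apply ind_congr
      unfold Marked
      rw [hs.size, h 4 (by norm_num), h 5 (by norm_num), h 6 (by norm_num), hs.coords.1,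
        hs.coords.2.1, hs.coords.2.2.1, hs.coords.2.2.2]) (greedyLoop m) (greedyLoop m).size).1 a h7
  rw [h2, (greedyLoop_spec m).1 a h6]

theorem select_sameInput (m : Mem) : SameInput m (select m) :=
  sameInput_of_arr fun a ha => select_off m a (by omega) (by omega)

theorem select_seven (m : Mem) : ∀ v < m.size, select m 7 v = ind (Cand m.size (m 4 1)
    (Marked 5 m) (fun u => u < m.size ∧ greedyLoop m 6 u = 1) (nA m) (nB m) (nH m) (nT m) v) := by
  intro v hv
  have hg := (greedyLoop_spec m).1
  have hs : SameInput m (greedyLoop m) := sameInput_of_arr fun a ha => hg a (by omega)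
  have h2 := iter_set (c := 7) (val := fun v m =>
    ind (Cand m.size (m 4 1) (Marked 5 m) (Marked 6 m) (nA m) (nB m) (nH m) (nT m) v)) (by
      intro i m m' h _
      have hs : SameInput m m' := sameInput_of_arr fun a ha => h a (by omega)
      apply ind_congr
      unfold Marked
      rw [hs.size, h 4 (by norm_num), h 5 (by norm_num), h 6 (by norm_num), hs.coords.1,
        hs.coords.2.1, hs.coords.2.2.1, hs.coords.2.2.2]) (greedyLoop m) (greedyLoop m).size
  have h3 := h2.2 v (hs.size.symm ▸ hv)
  have h1 := h2.1
  change ∀ a ≠ 7, select m a = greedyLoop m a at h1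
  change select m 7 v = ind (Cand (select m).size (select m 4 1) (Marked 5 (select m))
    (Marked 6 (select m)) (nA (select m)) (nB (select m)) (nH (select m)) (nT (select m)) v) at h3
  have hs' := select_sameInput m
  rw [h3]
  unfold Marked
  rw [hs'.size, hs'.coords.1, hs'.coords.2.1, hs'.coords.2.2.1, hs'.coords.2.2.2,
    select_off m 4 (by norm_num) (by norm_num), select_off m 5 (by norm_num) (by norm_num),
    h1 6 (by norm_num)]

/-! ### Properties of the selected set, and its computation -/

theorem Cand.mem {n k : ℕ} {A G : ℕ → Prop} {a b h t : ℕ → ℕ} {v : ℕ} (hG : ∀ v, G v → A v)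
    (H : Cand n k A G a b h t v) : A v := by
  rcases H with H | ⟨-, ⟨-, H | H | H⟩ | ⟨-, H | H | H⟩⟩
  · exact hG v H.1
  all_goals exact H.1.1.1

/-- All paths are normal in the normalized coordinates. -/
def AllNormal (m : Mem) : Prop := ∀ v < m.size, Normal (nA m) (nB m) (nH m) (nT m) v

theorem greedy_marked (m : Mem) (v : ℕ) (h : v < m.size ∧ greedyLoop m 6 v = 1) : Marked 5 m v :=
  (((greedyLoop_spec m).2 v h.1).1 h.2).1

theorem select_mem (m : Mem) {v : ℕ} (hv : v < m.size) (h : select m 7 v = 1) : m 5 v = 1 := by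
  rw [select_seven m v hv, ind_eq_one] at h
  exact (h.mem (greedy_marked m)).2

theorem select_le_one (m : Mem) {v : ℕ} (hv : v < m.size) : select m 7 v ≤ 1 := by
  rw [select_seven m v hv]; exact ind_le_one _

theorem select_card (m : Mem) :
    ((Finset.range m.size).filter fun v => select m 7 v = 1).card ≤ 6 * (m 4 1) ^ 2 := by
  classical
  refine le_trans (Finset.card_le_card ?_) (card_cand_le (n := m.size) (k := m 4 1)
    (A := Marked 5 m) (G := fun u => u < m.size ∧ greedyLoop m 6 u = 1) (a := nA m) (b := nB m)
    (h := nH m) (t := nT m))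
  intro v hv
  simp only [Finset.mem_filter, Finset.mem_range] at hv ⊢
  exact ⟨hv.1, ind_eq_one.1 (by rw [← select_seven m v hv.1]; exact hv.2)⟩

theorem Share.symm {a b h t : ℕ → ℕ} {u v : ℕ} (H : Share a b h t u v) : Share a b h t v u := by
  unfold Share at *; omega

theorem select_exists {m : Mem} (hm : AllNormal m) (hk : 0 < m 4 1) {S : Finset ℕ}
    (hS : IsSol (NConf m) (Marked 5 m) (m 4 1) S) :
    ∃ v < m.size, select m 7 v = 1 ∧ ∃ S', IsSol (NConf m) (Marked 5 m) (m 4 1) S' ∧ v ∈ S' := by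
  obtain ⟨v, hv, S', hS', hvS⟩ := exists_cand (n := m.size) (A := Marked 5 m)
    (G := fun u => u < m.size ∧ greedyLoop m 6 u = 1) (fun v hv => hv.1) (fun v hv => hm v hv.1)
    (greedy_marked m) (by
      intro u v hu hv hne hsh
      wlog huv : u < v generalizing u v
      · exact this v u hv hu hne.symm hsh.symm (by omega)
      · exact (((greedyLoop_spec m).2 v hv.1).1 hv.2).2 ⟨u, hu.1, ⟨huv, hu.2⟩, hsh⟩) (by
      intro v hv hnot
      by_contra hno
      refine hnot ⟨hv.1, ((greedyLoop_spec m).2 v hv.1).2 ⟨hv, ?_⟩⟩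
      rintro ⟨u, hu, ⟨-, hu'⟩, hsh⟩
      exact hno ⟨u, ⟨hu, hu'⟩, hsh⟩) hk hS
  have hvn := (hS'.1 v hvS).1
  exact ⟨v, hvn, by rw [select_seven m v hvn]; exact ind_eq_one.2 hv, S', hS', hvS⟩

theorem PredFn.marked (a : ℕ) : PredFn (Marked a) := fun hx =>
  .and (.lt hx .size) (.eq (.arr a hx) (.const 1))

theorem Cmd.select : Cmd fun (_ : Unit) m => select m :=
  .comp (F := fun _ m => greedyLoop m) (G := fun _ m => candLoop m)
    (.forLoop (F := fun _ v m => m.set 6 v (ind (Marked 5 m v ∧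
        ¬ ∃ u < m.size, (u < v ∧ m 6 u = 1) ∧ NShare m u v)))
      (.store 6 .var (Pred.and (PredFn.marked 5 .var) (.not (.ex
        (P := fun (e : Unit × ℕ) u m => (u < e.2 ∧ m 6 u = 1) ∧ NShare m u e.2)
        (.and (.and (.lt .var (.weak .var)) (.eq (.arr 6 .var) (.const 1)))
          (.share EvFn.nA EvFn.nB EvFn.nH EvFn.nT .var (.weak .var)))))) (Or.inl (by norm_num))))
    (.forLoop (F := fun _ v m => m.set 7 v (ind (Cand m.size (m 4 1) (Marked 5 m) (Marked 6 m)
        (nA m) (nB m) (nH m) (nT m) v)))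
      (.store 7 .var (PredFn.cand (fun _ => .arr 4 (.const 1)) (PredFn.marked 5) (PredFn.marked 6)
        EvFn.nA EvFn.nB EvFn.nH EvFn.nT .var) (Or.inl (by norm_num))))


/-! ## The search tree -/

/-- A bound on the number of nodes of the search tree for solutions of a given size. -/
def treeSize : ℕ → ℕ
  | 0 => 1
  | r + 1 => 1 + 6 * (r + 1) ^ 2 * treeSize r

/-- The summand 1 on the left makes the induction work: multiplied by `6 * (r + 1) ^ 2`, it pays for
the root of the next tree and for the new summand 1. -/
theorem treeSize_le (r : ℕ) : treeSize r + 1 ≤ 2 * (6 ^ r * r.factorial ^ 2) := by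
  induction r with
  | zero => simp [treeSize]
  | succ r ih =>
    have h := Nat.mul_le_mul_left (6 * (r + 1) ^ 2) ih
    rw [Nat.factorial_succ, treeSize]
    have h1 : 6 * (r + 1) ^ 2 * (2 * (6 ^ r * r.factorial ^ 2)) =
      2 * (6 ^ (r + 1) * ((r + 1) * r.factorial) ^ 2) := by ring
    rw [h1] at h
    rw [mul_add] at h
    have h2 : 1 ≤ (r + 1) ^ 2 := Nat.one_le_pow _ _ (Nat.succ_pos r)
    omega

/-- Bernoulli's inequality with the real exponent `k / 5 ≥ 1` gives `(1 + 1 / k) ^ (k / 5) ≥ 6 / 5`,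
and the tenth power of `6 / 5` exceeds 6. -/
theorem six_mul_pow_le {k : ℕ} (hk : 5 ≤ k) : 6 * k ^ (2 * k) ≤ (k + 1) ^ (2 * k) := by
  have hk' : (5 : ℝ) ≤ k := by exact_mod_cast hk
  have h0 : (0 : ℝ) < k := by linarith
  have h1 := one_add_mul_self_le_rpow_one_add (s := 1 / (k : ℝ)) (p := (k : ℝ) / 5)
    (by have : 0 < 1 / (k : ℝ) := by positivity
        linarith) (by linarith)
  have h2 : (k : ℝ) / 5 * (1 / k) = 1 / 5 := by field_simp
  rw [h2] at h1
  have h3 : ((1 + 1 / (k : ℝ)) ^ ((k : ℝ) / 5)) ^ 10 = (1 + 1 / (k : ℝ)) ^ (2 * k) := by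
    rw [← Real.rpow_natCast, ← Real.rpow_mul (by positivity), ← Real.rpow_natCast]
    congr 1
    push_cast
    ring
  have h4 : (6 : ℝ) ≤ (1 + 1 / (k : ℝ)) ^ (2 * k) := by
    rw [← h3]
    calc (6 : ℝ) ≤ (1 + 1 / 5) ^ 10 := by norm_num
      _ ≤ _ := by gcongr
  have h5 : (6 : ℝ) * k ^ (2 * k) ≤ (k + 1) ^ (2 * k) := by
    calc (6 : ℝ) * k ^ (2 * k) ≤ (1 + 1 / (k : ℝ)) ^ (2 * k) * k ^ (2 * k) := by gcongr
      _ = (k + 1) ^ (2 * k) := by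
        rw [← mul_pow]
        congr 1
        field_simp
  exact_mod_cast h5

/-- From 5 on the right side grows at least as fast as the left, by `six_mul_pow_le`; the factor 12
is chosen to cover the values up to 5. -/
theorem pow_mul_factorial_le (k : ℕ) : 6 ^ k * k.factorial ^ 2 ≤ 12 * k ^ (2 * k) := by
  rcases Nat.le_total k 5 with hk | hk
  · interval_cases k <;> simp [Nat.factorial]
  · induction k, hk using Nat.le_induction with
    | base => simp [Nat.factorial]
    | succ k hk ih =>
      calc 6 ^ (k + 1) * (k + 1).factorial ^ 2
          = 6 * (k + 1) ^ 2 * (6 ^ k * k.factorial ^ 2) := by rw [Nat.factorial_succ]; ring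
        _ ≤ 6 * (k + 1) ^ 2 * (12 * k ^ (2 * k)) := Nat.mul_le_mul_left _ ih
        _ = 12 * (k + 1) ^ 2 * (6 * k ^ (2 * k)) := by ring
        _ ≤ 12 * (k + 1) ^ 2 * (k + 1) ^ (2 * k) := Nat.mul_le_mul_left _ (six_mul_pow_le hk)
        _ = 12 * (k + 1) ^ (2 * (k + 1)) := by ring

theorem treeSize_le_pow (k : ℕ) : treeSize k ≤ 24 * k ^ (2 * k) := by
  have h1 := treeSize_le k
  have h2 := pow_mul_factorial_le k
  omega

/-- What remains of `A` after the choice of `v`. -/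
def child (C : ℕ → ℕ → Prop) (A : ℕ → Prop) (v w : ℕ) : Prop := (A w ∧ w ≠ v) ∧ ¬ C v w

theorem IsSol.child {C : ℕ → ℕ → Prop} {A : ℕ → Prop} {k v : ℕ} {S : Finset ℕ}
    (hS : IsSol C A (k + 1) S) (hv : v ∈ S) : IsSol C (child C A v) k (S.erase v) := by
  refine ⟨fun w hw => ?_, by rw [Finset.card_erase_of_mem hv, hS.2.1]; rfl, fun u hu w hw =>
    hS.2.2 u (Finset.mem_of_mem_erase hu) w (Finset.mem_of_mem_erase hw)⟩
  have h1 := Finset.mem_of_mem_erase hw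
  have h2 := Finset.ne_of_mem_erase hw
  exact ⟨⟨hS.1 w h1, h2⟩, hS.2.2 v hv w h1 h2.symm⟩

theorem IsSol.of_child {C : ℕ → ℕ → Prop} {A : ℕ → Prop} {k v : ℕ} {S : Finset ℕ}
    (hC : ∀ u v, C u v → C v u) (hv : A v) (hS : IsSol C (EPG.child C A v) k S) :
    IsSol C A (k + 1) (insert v S) := by
  refine ⟨fun w hw => ?_, ?_, fun u hu w hw huw => ?_⟩
  · rcases Finset.mem_insert.1 hw with rfl | hw
    · exact hv
    · exact (hS.1 w hw).1.1
  · rw [Finset.card_insert_of_notMem fun h => (hS.1 v h).1.2 rfl, hS.2.1]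
  · rcases Finset.mem_insert.1 hu with hu | hu <;> rcases Finset.mem_insert.1 hw with hw | hw
    · exact absurd (hu.trans hw.symm) huw
    · exact hu ▸ (hS.1 w hw).2
    · exact hw ▸ fun h => (hS.1 u hu).2 (hC _ _ h)
    · exact hS.2.2 u hu w hw huw

/-! ### The stack of the search and one search step -/

theorem Mem.set_apply (m : Mem) (c i v a j : ℕ) :
    m.set c i v a j = if a = c ∧ j = i then v else m a j := by
  unfold Mem.set
  by_cases h : a = c
  · subst h
    by_cases h' : j = i <;> simp [h']
  · simp [h]

/-- Remove the top frame of the stack: the number of frames is in `4 2`. -/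
def moveTop (m : Mem) : Mem := m.set 4 2 (m 4 2 - 1)

/-- Move the start of the first free frame, which is in `4 3`, below the removed frame. -/
def moveBase (m : Mem) : Mem := m.set 4 3 (m 4 3 - m.size)

/-- Store in `4 1` the size of the solution wanted for the removed frame. -/
def readGoal (m : Mem) : Mem := m.set 4 1 (m 9 (m 4 2))

/-- Record success in `4 4` if this size is zero. -/
def raiseFlag (m : Mem) : Mem := m.set 4 4 (if m 4 1 = 0 then 1 else m 4 4)

/-- Take the top frame off the stack. -/
def popVars (m : Mem) : Mem := raiseFlag (readGoal (moveBase (moveTop m)))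

/-- Copy the frame taken off to array `5`. -/
def copyFrame (m : Mem) : Mem := iter (fun v m => m.set 5 v (m 8 (m 4 3 + v))) m.size m

/-- Write the vertices that remain after the choice of `v` to the first free frame. -/
noncomputable def writeFrame (v : ℕ) (m : Mem) : Mem :=
  iter (fun w m => m.set 8 (m 4 3 + w) (ind ((m 5 w = 1 ∧ w ≠ v) ∧ ¬ NConf m v w))) m.size m

/-- Write the size of the solution wanted for the first free frame. -/
def writeGoal (m : Mem) : Mem := m.set 9 (m 4 2) (m 4 1 - 1)

/-- Count the written frame if `v` is a candidate. -/
def addTop (v : ℕ) (m : Mem) : Mem := m.set 4 2 (m 4 2 + m 7 v)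

/-- Move the start of the first free frame if `v` is a candidate. -/
def addBase (v : ℕ) (m : Mem) : Mem := m.set 4 3 (m 4 3 + if m 7 v = 1 then m.size else 0)

/-- Write the frame for the choice of `v`, and count it if `v` is a candidate. -/
noncomputable def pushOne (v : ℕ) (m : Mem) : Mem :=
  addBase v (addTop v (writeGoal (writeFrame v m)))

/-- One step of the search. -/
noncomputable def searchStep (m : Mem) : Mem :=
  let m' := select (copyFrame (popVars m))
  iter pushOne m'.size m'

/-- Memory layout: arrays `0` to `3` hold the paths and array `4` the variables (size, current goal,
number of frames, start of the first free frame, success flag). Arrays `5`, `6`, `7` mark the alive,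
greedy and candidate vertices; array `8` holds the frames, one block of length `size` each, and
array `9` their goals. -/
theorem popVars_spec (m : Mem) : (∀ a ≠ 4, popVars m a = m a) ∧ popVars m 4 0 = m 4 0 ∧
    popVars m 4 1 = m 9 (m 4 2 - 1) ∧ popVars m 4 2 = m 4 2 - 1 ∧
    popVars m 4 3 = m 4 3 - m.size ∧
    popVars m 4 4 = if m 9 (m 4 2 - 1) = 0 then 1 else m 4 4 := by
  refine ⟨fun a ha => ?_, ?_⟩
  · ext j; simp [popVars, raiseFlag, readGoal, moveBase, moveTop, Mem.set_apply, ha]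
  · simp [popVars, raiseFlag, readGoal, moveBase, moveTop, Mem.set_apply, Mem.size]

theorem copyFrame_spec (m : Mem) : (∀ a ≠ 5, copyFrame m a = m a) ∧
    ∀ v < m.size, copyFrame m 5 v = m 8 (m 4 3 + v) := by
  have h := iter_set (c := 5) (val := fun v m => m 8 (m 4 3 + v)) (by
    intro i m m' h _
    simp only [h 8 (by norm_num), h 4 (by norm_num)]) m m.size
  change (∀ a ≠ 5, copyFrame m a = m a) ∧
    ∀ v < m.size, copyFrame m 5 v = copyFrame m 8 (copyFrame m 4 3 + v) at h
  refine ⟨h.1, fun v hv => ?_⟩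
  rw [h.2 v hv, h.1 8 (by norm_num), h.1 4 (by norm_num)]

/-- A frame is written for every `v`, but the stack grows only if `v` is a candidate; otherwise the
slot is simply free for reuse. The machine cannot multiply in one step, so the start `m 4 2 *
m.size` of the free slot is kept up to date in `4 3`. -/
theorem pushOne_spec (m : Mem) (v : ℕ) (hb : m 4 3 = m 4 2 * m.size) (h1 : m 7 v ≤ 1) :
    (∀ a, a ≠ 4 → a ≠ 8 → a ≠ 9 → pushOne v m a = m a) ∧
    (∀ i, i ≠ 2 → i ≠ 3 → pushOne v m 4 i = m 4 i) ∧
    pushOne v m 4 2 = m 4 2 + m 7 v ∧ pushOne v m 4 3 = pushOne v m 4 2 * m.size ∧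
    (∀ j < m 4 2, pushOne v m 9 j = m 9 j ∧
      ∀ w < m.size, pushOne v m 8 (j * m.size + w) = m 8 (j * m.size + w)) ∧
    pushOne v m 9 (m 4 2) = m 4 1 - 1 ∧ ∀ w < m.size, pushOne v m 8 (m 4 2 * m.size + w) =
      ind ((m 5 w = 1 ∧ w ≠ v) ∧ ¬ NConf m v w) := by
  obtain ⟨g1, g2, g3⟩ := iter_map (c := 8) (off := fun m => m 4 3)
    (val := fun w m => ind ((m 5 w = 1 ∧ w ≠ v) ∧ ¬ NConf m v w))
    (by intro m m' h; simp only [h 4 (by norm_num)])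
    (by
      intro i m m' h
      have hs : SameInput m m' := sameInput_of_arr fun a ha => h a (by omega)
      simp only [h 5 (by norm_num), hs.nconf]) m m.size
  have hM : pushOne v m = addBase v (addTop v (writeGoal (writeFrame v m))) := rfl
  unfold writeFrame at hM
  generalize hI : iter (fun w m => m.set 8 (m 4 3 + w)
    (ind ((m 5 w = 1 ∧ w ≠ v) ∧ ¬ NConf m v w))) m.size m = I at hM g1 g2 g3
  have e4 := g1 4 (by norm_num)
  have e7 := g1 7 (by norm_num)
  have e9 := g1 9 (by norm_num)
  have hsz : I.size = m.size := by unfold Mem.size; rw [e4]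
  have hM' : ∀ a j, pushOne v m a j = if a = 4 ∧ j = 3 then
      m 4 3 + (if m 7 v = 1 then m.size else 0) else if a = 4 ∧ j = 2 then m 4 2 + m 7 v
      else if a = 9 ∧ j = m 4 2 then m 4 1 - 1 else I a j := by
    intro a j
    rw [hM]
    simp only [addBase, addTop, writeGoal, Mem.set_apply, Mem.size, e4, e7]
    simp
  refine ⟨fun a h4 h8 h9 => ?_, fun i h2 h3 => ?_, ?_, ?_, fun j hj => ⟨?_, fun w hw => ?_⟩, ?_,
    fun w hw => ?_⟩
  · ext j; rw [hM', g1 a h8]; simp [h4, h9]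
  · rw [hM', e4]; simp [h2, h3]
  · rw [hM']; simp
  · rw [hM', hM', hb]
    rcases Nat.le_one_iff_eq_zero_or_eq_one.1 h1 with h | h <;> simp [h, add_mul]
  · rw [hM', e9]; simp [hj.ne]
  · rw [hM']
    simp only [Nat.reduceEqDiff, false_and, if_false]
    apply g3
    left
    rw [hb]
    have : (j + 1) * m.size ≤ m 4 2 * m.size := Nat.mul_le_mul_right _ hj
    rw [add_mul, one_mul] at this
    omega
  · rw [hM']; simp
  · rw [hM']
    simp only [Nat.reduceEqDiff, false_and, if_false]
    rw [← hb]
    exact g2 w hw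

/-- Frame `j` of `M` is the one written for the choice of `u` in state `m`. -/
def IsChild (m M : Mem) (u j : ℕ) : Prop :=
  M 9 j = m 4 1 - 1 ∧ ∀ w < m.size, M 8 (j * m.size + w) =
    ind ((m 5 w = 1 ∧ w ≠ u) ∧ ¬ NConf m u w)

/-- The stack of `M` is that of `m` with frames pushed for the candidates below `v`. -/
structure Pushed (m M : Mem) (v : ℕ) : Prop where
  off : ∀ a, a ≠ 4 → a ≠ 8 → a ≠ 9 → M a = m a
  vars : ∀ i, i ≠ 2 → i ≠ 3 → M 4 i = m 4 i
  top : M 4 2 = m 4 2 + ((Finset.range v).filter fun u => m 7 u = 1).card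
  base : M 4 3 = M 4 2 * m.size
  old : ∀ j < m 4 2, M 9 j = m 9 j ∧ ∀ w < m.size, M 8 (j * m.size + w) = m 8 (j * m.size + w)
  new : ∀ j, m 4 2 ≤ j → j < M 4 2 → ∃ u < v, m 7 u = 1 ∧ IsChild m M u j
  all : ∀ u < v, m 7 u = 1 → ∃ j, m 4 2 ≤ j ∧ j < M 4 2 ∧ IsChild m M u j

theorem Pushed.sameInput {m M : Mem} {v : ℕ} (h : Pushed m M v) : SameInput m M :=
  ⟨h.vars 0 (by norm_num) (by norm_num), fun a ha =>
    h.off a (by omega) (by omega) (by omega)⟩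

theorem pushed_iter {m : Mem} (hb : m 4 3 = m 4 2 * m.size) (h7 : ∀ v < m.size, m 7 v ≤ 1) :
    ∀ v ≤ m.size, Pushed m (iter pushOne v m) v := by
  intro v
  induction v with
  | zero =>
    intro _
    exact ⟨fun _ _ _ _ => rfl, fun _ _ _ => rfl, by simp [iter_zero], hb,
      fun _ _ => ⟨rfl, fun _ _ => rfl⟩, fun j h1 h2 => by rw [iter_zero] at h2; omega, by omega⟩
  | succ v ih =>
    intro hv
    have ih := ih (by omega)
    rw [iter_succ]
    generalize iter pushOne v m = M at ih
    have hs := ih.sameInput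
    have e7 := ih.off 7 (by norm_num) (by norm_num) (by norm_num)
    have hv1 := h7 v (by omega)
    obtain ⟨p1, p2, p3, p4, p5, p6, p7⟩ := pushOne_spec M v (by rw [ih.base, hs.size])
      (by rw [e7]; exact hv1)
    rw [hs.size] at p4 p5 p7
    rw [e7] at p3
    have htop : m 4 2 ≤ M 4 2 := by rw [ih.top]; omega
    have hchild : ∀ u j, j < M 4 2 → IsChild m M u j → IsChild m (pushOne v M) u j := by
      intro u j hj h
      refine ⟨by rw [(p5 j hj).1, h.1], fun w hw => ?_⟩
      rw [(p5 j hj).2 w hw, h.2 w hw]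
    have hnew : IsChild m (pushOne v M) v (M 4 2) := by
      refine ⟨by rw [p6, ih.vars 1 (by norm_num) (by norm_num)], fun w hw => ?_⟩
      rw [p7 w hw, hs.nconf, ih.off 5 (by norm_num) (by norm_num) (by norm_num)]
    refine ⟨fun a h4 h8 h9 => (p1 a h4 h8 h9).trans (ih.off a h4 h8 h9),
      fun i h2 h3 => (p2 i h2 h3).trans (ih.vars i h2 h3), ?_, p4, fun j hj => ?_,
      fun j hj hj' => ?_, fun u hu hu' => ?_⟩
    · rw [p3, ih.top, Finset.range_add_one, Finset.filter_insert]
      split_ifs with h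
      · rw [Finset.card_insert_of_notMem (by simp), h]; ring
      · have : m 7 v = 0 := by omega
        rw [this]; ring
    · refine ⟨by rw [(p5 j (by omega)).1, (ih.old j hj).1], fun w hw => ?_⟩
      rw [(p5 j (by omega)).2 w hw, (ih.old j hj).2 w hw]
    · by_cases hjM : j < M 4 2
      · obtain ⟨u, hu, hu', hc⟩ := ih.new j hj hjM
        exact ⟨u, by omega, hu', hchild u j hjM hc⟩
      · rw [p3] at hj'
        have : j = M 4 2 := by omega
        subst this
        exact ⟨v, by omega, by omega, hnew⟩
    · rcases (Nat.lt_succ_iff.1 hu).lt_or_eq with hu | rfl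
      · obtain ⟨j, hj, hj', hc⟩ := ih.all u hu hu'
        exact ⟨j, hj, by omega, hchild u j hj' hc⟩
      · exact ⟨M 4 2, htop, by omega, hnew⟩

/-- The vertices of frame `j`. -/
def Frame (m : Mem) (j w : ℕ) : Prop := w < m.size ∧ m 8 (j * m.size + w) = 1

/-- The invariant of the search for a solution of the relation `C` on `n` vertices. -/
structure SearchInv (m₀ : Mem) (goal : Prop) (m : Mem) : Prop where
  same : SameInput m₀ m
  base : m 4 3 = m 4 2 * m.size
  flag : m 4 4 ≤ 1
  iff : goal ↔ m 4 4 = 1 ∨ ∃ j < m 4 2, ∃ S, IsSol (NConf m₀) (Frame m j) (m 9 j) S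

/-- The total size of the search trees below the frames on the stack. -/
def potential (m : Mem) : ℕ := ∑ j ∈ Finset.range (m 4 2), treeSize (m 9 j)

/-- The state of the search after the candidates for the top frame have been marked. -/
theorem select_top_spec {m m' : Mem} (hm' : m' = select (copyFrame (popVars m)))
    (hb : m 4 3 = m 4 2 * m.size) :
    SameInput m m' ∧ m' 8 = m 8 ∧ m' 9 = m 9 ∧ m' 4 1 = m 9 (m 4 2 - 1) ∧ m' 4 2 = m 4 2 - 1 ∧
    m' 4 3 = m' 4 2 * m'.size ∧ (m' 4 4 = if m 9 (m 4 2 - 1) = 0 then 1 else m 4 4) ∧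
    ∀ w, Marked 5 m' w ↔ Frame m (m 4 2 - 1) w := by
  obtain ⟨p0, p1, p2, p3, p4, p5⟩ := popVars_spec m
  obtain ⟨c1, c2⟩ := copyFrame_spec (popVars m)
  have hoff := select_off (copyFrame (popVars m))
  rw [← hm'] at hoff
  have h4 : m' 4 = popVars m 4 := by rw [hoff 4 (by norm_num) (by norm_num), c1 4 (by norm_num)]
  have hother : ∀ a, a ≠ 4 → a ≠ 5 → a ≠ 6 → a ≠ 7 → m' a = m a := fun a h4 h5 h6 h7 => by
    rw [hoff a h6 h7, c1 a h5, p0 a h4]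
  have hsz : m'.size = m.size := by unfold Mem.size; rw [h4, p1]
  have hbase : m' 4 3 = m' 4 2 * m'.size := by
    rw [hsz, h4, p4, p3, hb, Nat.sub_mul, one_mul]
  refine ⟨⟨hsz, fun a ha => hother a (by omega) (by omega) (by omega) (by omega)⟩,
    hother 8 (by norm_num) (by norm_num) (by norm_num) (by norm_num),
    hother 9 (by norm_num) (by norm_num) (by norm_num) (by norm_num), by rw [h4, p2],
    by rw [h4, p3], hbase, by rw [h4, p5], fun w => ?_⟩
  unfold Marked Frame
  rw [hsz]
  refine and_congr_right fun hw => ?_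
  have hszp : (popVars m).size = m.size := p1
  rw [hoff 5 (by norm_num) (by norm_num), c2 w (hszp.symm ▸ hw), p0 8 (by norm_num),
    ← congrFun h4 3, hbase, hsz, h4, p3]

/-- A solution for the top frame may be assumed to contain a candidate, and removing that candidate
leaves a solution for its child; conversely a solution for a child extends by the chosen vertex. At
most `6 * r ^ 2` children with goal `r - 1` replace a frame with goal `r`, so by the recursion for
`treeSize` the potential drops. -/
theorem SearchInv.step {m₀ m : Mem} {goal : Prop} (h3 : AllNormal m₀) (h : SearchInv m₀ goal m)
    (hs : 0 < m 4 2) : SearchInv m₀ goal (searchStep m) ∧ potential (searchStep m) < potential m := by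
  obtain ⟨s, hs'⟩ : ∃ s, m 4 2 = s + 1 := ⟨m 4 2 - 1, by omega⟩
  obtain ⟨q1, q2, q3, q4, q5, q6, q7, q8⟩ := select_top_spec rfl h.base
  have hsel1 := fun v => select_le_one (copyFrame (popVars m)) (v := v)
  have hselA := fun v => select_mem (copyFrame (popVars m)) (v := v)
  have hselC := select_card (copyFrame (popVars m))
  have hselE := @select_exists (copyFrame (popVars m))
  have hsel := select_sameInput (copyFrame (popVars m))
  have hoff := select_off (copyFrame (popVars m))
  have hstep : searchStep m = iter pushOne (select (copyFrame (popVars m))).size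
    (select (copyFrame (popVars m))) := rfl
  -- The facts on the selection are restated for the memory after it, so that this memory can be
  -- generalized.
  unfold Marked at hselE
  rw [← hsel.size, ← hoff 5 (by norm_num) (by norm_num), ← hsel.nconf,
    ← hoff 4 (by norm_num) (by norm_num)] at hselE
  rw [← hsel.size] at hsel1 hselA hselC
  rw [← hoff 5 (by norm_num) (by norm_num)] at hselA
  rw [← hoff 4 (by norm_num) (by norm_num)] at hselC
  have hTS : AllNormal (copyFrame (popVars m)) := by
    have hc := hsel.coords
    have hc' := (h.same.trans q1).coords
    unfold AllNormal
    rw [← hc.1, ← hc.2.1, ← hc.2.2.1, ← hc.2.2.2, ← hsel.size, hc'.1, hc'.2.1, hc'.2.2.1,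
      hc'.2.2.2, (h.same.trans q1).size]
    exact h3
  have hselE := fun hk S => hselE hTS hk (S := S)
  clear hTS hoff hsel
  generalize select (copyFrame (popVars m)) = m' at *
  rw [hstep]
  have hP := pushed_iter q6 hsel1 m'.size le_rfl
  generalize iter pushOne m'.size m' = M at *
  have hsame := (h.same.trans q1).trans hP.sameInput
  have hnc : NConf m' = NConf m₀ := (h.same.trans q1).nconf
  have hszM : M.size = m'.size := hP.sameInput.size
  have hflag : M 4 4 = if m 9 s = 0 then 1 else m 4 4 := by
    rw [hP.vars 4 (by norm_num) (by norm_num), q7, hs']; rfl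
  have hk : m' 4 1 = m 9 s := by rw [q4, hs']; rfl
  have htop : m' 4 2 = s := by rw [q5, hs']; rfl
  have hfr : ∀ w, (w < m'.size ∧ m' 5 w = 1) ↔ Frame m s w := by
    intro w
    have := q8 w
    rw [hs'] at this
    exact this
  have hold : ∀ j < s, M 9 j = m 9 j ∧ ∀ w, Frame M j w ↔ Frame m j w := by
    intro j hj
    obtain ⟨e1, e2⟩ := hP.old j (by omega)
    refine ⟨by rw [e1, q3], fun w => ?_⟩
    unfold Frame
    rw [hszM, q1.size]
    refine and_congr_right fun hw => ?_
    have := e2 w (q1.size.symm ▸ hw)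
    rw [q1.size] at this
    rw [this, q2]
  have hchildF : ∀ u j, IsChild m' M u j → Frame M j = child (NConf m₀) (Frame m s) u := by
    intro u j hc
    ext w
    unfold Frame
    rw [hszM]
    constructor
    · rintro ⟨hw, hw'⟩
      rw [hc.2 w hw, ind_eq_one, hnc] at hw'
      exact ⟨⟨(hfr w).1 ⟨hw, hw'.1.1⟩, hw'.1.2⟩, hw'.2⟩
    · rintro ⟨⟨hw, hne⟩, hC⟩
      obtain ⟨hw1, hw2⟩ := (hfr w).2 hw
      refine ⟨hw1, ?_⟩
      rw [hc.2 w hw1, ind_eq_one, hnc]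
      exact ⟨⟨hw2, hne⟩, hC⟩
  have hFrame : (fun w => w < m'.size ∧ m' 5 w = 1) = Frame m s := by ext w; exact hfr w
  rw [hnc, hFrame, hk] at hselE
  have hCs : ∀ u v, NConf m₀ u v → NConf m₀ v u := fun u v => Conf.symm
  refine ⟨⟨hsame, by rw [hP.base, hszM], ?_, ?_⟩, ?_⟩
  · rw [hflag]
    split_ifs
    · exact le_rfl
    · exact h.flag
  · rw [h.iff, hflag]
    have hsolOld : ∀ j < s, ∀ S, IsSol (NConf m₀) (Frame M j) (M 9 j) S ↔
        IsSol (NConf m₀) (Frame m j) (m 9 j) S := by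
      intro j hj S
      rw [(hold j hj).1, show Frame M j = Frame m j from funext fun w =>
        propext ((hold j hj).2 w)]
    have hsM : s ≤ M 4 2 := by rw [hP.top, htop]; omega
    constructor
    · rintro (hf | ⟨j, hj, S, hS⟩)
      · left; split_ifs
        · rfl
        · exact hf
      · rw [hs'] at hj
        rcases (Nat.lt_succ_iff.1 hj).lt_or_eq with hj | rfl
        · exact Or.inr ⟨j, by omega, S, (hsolOld j hj S).2 hS⟩
        · by_cases h0 : m 9 j = 0
          · left; rw [if_pos h0]
          · right
            obtain ⟨v, hv, hv7, S', hS', hvS⟩ := hselE (Nat.pos_of_ne_zero h0) S hS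
            obtain ⟨i, -, hi, hc⟩ := hP.all v hv hv7
            refine ⟨i, hi, S'.erase v, ?_⟩
            rw [hchildF v i hc, hc.1, hk]
            refine IsSol.child ?_ hvS
            rwa [Nat.sub_add_cancel (Nat.pos_of_ne_zero h0)]
    · rintro (hf | ⟨j, hj, S, hS⟩)
      · split_ifs at hf with h0
        -- The flag was raised because the goal of the top frame is zero, for which the empty set is
        -- a solution.
        · refine Or.inr ⟨s, by omega, ∅, by simp, ?_, by simp [Indep]⟩
          rw [h0]; rfl
        · exact Or.inl hf
      · by_cases hjs : j < s
        · exact Or.inr ⟨j, by omega, S, (hsolOld j hjs S).1 hS⟩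
        · obtain ⟨u, hu, hu7, hc⟩ := hP.new j (by omega) hj
          rw [hchildF u j hc, hc.1, hk] at hS
          have huF := (hfr u).1 ⟨hu, hselA u hu hu7⟩
          by_cases h0 : m 9 s = 0
          · exact Or.inr ⟨s, by omega, ∅, by simp, by rw [h0]; rfl, by simp [Indep]⟩
          · refine Or.inr ⟨s, by omega, insert u S, ?_⟩
            have := IsSol.of_child hCs huF hS
            rwa [Nat.sub_add_cancel (Nat.pos_of_ne_zero h0)] at this
  · unfold potential
    have h1 : ∑ j ∈ Finset.range (M 4 2), treeSize (M 9 j) =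
        ∑ j ∈ Finset.range s, treeSize (m 9 j) +
          ((Finset.range m'.size).filter fun u => m' 7 u = 1).card * treeSize (m 9 s - 1) := by
      rw [hP.top, htop, Finset.sum_range_add]
      congr 1
      · refine Finset.sum_congr rfl fun j hj => ?_
        rw [(hold j (Finset.mem_range.1 hj)).1]
      · rw [← smul_eq_mul]
        refine (Finset.sum_eq_card_nsmul fun i hi => ?_).trans (by rw [Finset.card_range])
        obtain ⟨u, -, -, hc⟩ := hP.new (s + i) (by omega) (by
          rw [hP.top, htop]; have := Finset.mem_range.1 hi; omega)
        rw [hc.1, hk]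
    rw [h1, hs', Finset.sum_range_succ]
    apply Nat.add_lt_add_left
    rw [hk] at hselC
    have h2 := Nat.mul_le_mul_right (treeSize (m 9 s - 1)) hselC
    rcases hr : m 9 s with _ | r
    -- A frame with goal zero has no candidates, so nothing replaces its contribution `treeSize 0 =
    -- 1`.
    · rw [hr, Nat.zero_pow (by norm_num), mul_zero, zero_mul] at h2
      simp only [treeSize, Nat.zero_sub] at h2 ⊢
      omega
    · rw [hr] at h2
      simp only [treeSize, Nat.add_sub_cancel] at h2 ⊢
      omega

theorem Cmd.searchStep : Cmd fun (_ : Unit) m => searchStep m := by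
  have h1 : Cmd fun (_ : Unit) m => moveTop m :=
    .store 4 (.const 2) (.sub (.arr 4 (.const 2)) (.const 1)) (by simp)
  have h2 : Cmd fun (_ : Unit) m => moveBase m :=
    .store 4 (.const 3) (.sub (.arr 4 (.const 3)) .size) (by simp)
  have h3 : Cmd fun (_ : Unit) m => readGoal m :=
    .store 4 (.const 1) (.arr 9 (.arr 4 (.const 2))) (by simp)
  have h4 : Cmd fun (_ : Unit) m => raiseFlag m :=
    .store 4 (.const 4) (.ite (.eq (.arr 4 (.const 1)) (.const 0)) (.const 1)
      (.arr 4 (.const 4))) (by simp)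
  have h5 : Cmd fun (_ : Unit) m => copyFrame m :=
    .forLoop (F := fun _ v m => m.set 5 v (m 8 (m 4 3 + v)))
      (.store 5 .var (.arr 8 (.add (.arr 4 (.const 3)) .var)) (by simp))
  have h6 : Cmd fun (e : Unit × ℕ) m => writeFrame e.2 m :=
    .forLoop (F := fun (e : Unit × ℕ) w m => m.set 8 (m 4 3 + w)
        (ind ((m 5 w = 1 ∧ w ≠ e.2) ∧ ¬ NConf m e.2 w)))
      (.store 8 (.add (.arr 4 (.const 3)) .var) (Pred.and (.and (.eq (.arr 5 .var) (.const 1))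
        (.not (.eq .var (.weak .var))))
        (.not (.conf EvFn.nA EvFn.nB EvFn.nH EvFn.nT (.weak .var) .var))) (by simp))
  have h7 : Cmd fun (_ : Unit × ℕ) m => writeGoal m :=
    .store 9 (.arr 4 (.const 2)) (.sub (.arr 4 (.const 1)) (.const 1)) (by simp)
  have h8 : Cmd fun (e : Unit × ℕ) m => addTop e.2 m :=
    .store 4 (.const 2) (.add (.arr 4 (.const 2)) (.arr 7 .var)) (by simp)
  have h9 : Cmd fun (e : Unit × ℕ) m => addBase e.2 m :=
    .store 4 (.const 3) (.add (.arr 4 (.const 3))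
      (.ite (.eq (.arr 7 .var) (.const 1)) .size (.const 0))) (by simp)
  have hpop : Cmd fun (_ : Unit) m => popVars m := ((h1.comp h2).comp h3).comp h4
  have hpush : Cmd fun (e : Unit × ℕ) m => pushOne e.2 m := ((h6.comp h7).comp h8).comp h9
  exact ((hpop.comp h5).comp .select).comp
    (G := fun _ m => iter pushOne m.size m) (.forLoop (F := fun _ => pushOne) hpush)


/-! ## Paths and memories -/

/-- If two collinear segments overlap, the unit edge starting at the larger of their lower ends is
common; a horizontal edge never equals a vertical one. -/
theorem edges_inter_nonempty {P Q : GridPath} : (P.edges ∩ Q.edges).Nonempty ↔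
    (P.cy = Q.cy ∧ Overlap P.cx P.hx Q.cx Q.hx) ∨ (P.cx = Q.cx ∧ Overlap P.cy P.vy Q.cy Q.vy) := by
  unfold Overlap
  constructor
  · rintro ⟨e, (⟨i, h1, h2, rfl⟩ | ⟨i, h1, h2, rfl⟩), (⟨j, h3, h4, h5⟩ | ⟨j, h3, h4, h5⟩)⟩
    · simp only [Sym2.eq_iff, Prod.mk.injEq] at h5
      left; omega
    · simp only [Sym2.eq_iff, Prod.mk.injEq] at h5
      omega
    · simp only [Sym2.eq_iff, Prod.mk.injEq] at h5
      omega
    · simp only [Sym2.eq_iff, Prod.mk.injEq] at h5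
      right; omega
  · rintro (⟨h1, h2⟩ | ⟨h1, h2⟩)
    · refine ⟨s((max (min P.cx P.hx) (min Q.cx Q.hx), P.cy),
        (max (min P.cx P.hx) (min Q.cx Q.hx) + 1, P.cy)), Or.inl ⟨_, ?_, ?_, rfl⟩,
        Or.inl ⟨max (min P.cx P.hx) (min Q.cx Q.hx), ?_, ?_, by rw [h1]⟩⟩ <;> omega
    · refine ⟨s((P.cx, max (min P.cy P.vy) (min Q.cy Q.vy)),
        (P.cx, max (min P.cy P.vy) (min Q.cy Q.vy) + 1)), Or.inr ⟨_, ?_, ?_, rfl⟩,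
        Or.inr ⟨max (min P.cy P.vy) (min Q.cy Q.vy), ?_, ?_, by rw [h1]⟩⟩ <;> omega

/-! ### Correspondence between path families and machine memories -/

section
variable {n : ℕ} (R : Fin n → GridPath) (k : ℕ)

/-- The memory with the paths, their number and the size of the wanted solution. -/
def inputMem : Mem := Mem.set (Mem.set (input R k).arr 4 0 n) 4 1 k

theorem inputMem_size : (inputMem R k).size = n := by
  simp [inputMem, Mem.size, Mem.set_apply]

theorem inputMem_goal : inputMem R k 4 1 = k := by simp [inputMem, Mem.set_apply]

theorem inputMem_flag : inputMem R k 4 4 = 0 := by simp [inputMem, Mem.set_apply, input]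

theorem inputMem_coords (v : Fin n) : inputMem R k 0 v = (R v).cx ∧ inputMem R k 1 v = (R v).cy ∧
    inputMem R k 2 v = (R v).hx ∧ inputMem R k 3 v = (R v).vy := by
  simp [inputMem, Mem.set_apply, input]

theorem nconf_inputMem (u v : Fin n) :
    NConf (inputMem R k) u v ↔ ((R u).edges ∩ (R v).edges).Nonempty := by
  have hsz := inputMem_size R k
  rw [edges_inter_nonempty]
  unfold NConf
  rw [conf_coords (hsz.symm ▸ u.2) (hsz.symm ▸ v.2)]
  obtain ⟨a1, a2, a3, a4⟩ := inputMem_coords R k u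
  obtain ⟨b1, b2, b3, b4⟩ := inputMem_coords R k v
  unfold Conf
  rw [a1, a2, a3, a4, b1, b2, b3, b4]

theorem isSol_map_iff (S : Finset (Fin n)) :
    IsSol (NConf (inputMem R k)) (· < n) k (S.map Fin.valEmbedding) ↔
      (graph R).IsNIndepSet k S := by
  rw [SimpleGraph.isNIndepSet_iff]
  unfold IsSol Indep SimpleGraph.IsIndepSet Set.Pairwise
  rw [Finset.card_map]
  constructor
  · rintro ⟨-, h1, h2⟩
    refine ⟨fun u hu v hv huv hadj => h2 u (Finset.mem_map_of_mem _ hu) v (Finset.mem_map_of_mem _ hv)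
      (fun h => huv (Fin.ext h)) ((nconf_inputMem R k u v).2 hadj.2), h1⟩
  · rintro ⟨h1, h2⟩
    refine ⟨fun v hv => ?_, h2, fun u hu v hv huv hc => ?_⟩
    · obtain ⟨w, -, rfl⟩ := Finset.mem_map.1 hv
      exact w.2
    · obtain ⟨u, hu, rfl⟩ := Finset.mem_map.1 hu
      obtain ⟨v, hv, rfl⟩ := Finset.mem_map.1 hv
      have huv : u ≠ v := fun h => huv (by rw [h])
      exact h1 ((Finset.mem_map' _).1 hu) ((Finset.mem_map' _).1 hv) huv ⟨huv, (nconf_inputMem R k u v).1 hc⟩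

theorem exists_map_of_lt {S : Finset ℕ} (hS : ∀ v ∈ S, v < n) :
    ∃ S' : Finset (Fin n), S'.map Fin.valEmbedding = S :=
  ⟨S.attachFin hS, S.map_valEmbedding_attachFin hS⟩

theorem exists_isSol_iff : (∃ S, IsSol (NConf (inputMem R k)) (· < n) k S) ↔
    ∃ S, (graph R).IsNIndepSet k S := by
  constructor
  · rintro ⟨S, hS⟩
    obtain ⟨S', rfl⟩ := exists_map_of_lt hS.1
    exact ⟨S', (isSol_map_iff R k S').1 hS⟩
  · rintro ⟨S, hS⟩
    exact ⟨_, (isSol_map_iff R k S).2 hS⟩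

theorem le_indepNum_iff : k ≤ (graph R).indepNum ↔ ∃ S, (graph R).IsNIndepSet k S := by
  constructor
  · intro h
    obtain ⟨S, hS⟩ := (graph R).exists_isNIndepSet_indepNum
    rw [SimpleGraph.isNIndepSet_iff] at hS
    obtain ⟨S', hS', hk⟩ := Finset.exists_subset_card_eq (h.trans hS.2.ge)
    exact ⟨S', (SimpleGraph.isNIndepSet_iff _ _ _).2
      ⟨hS.1.mono (Finset.coe_subset.2 hS'), hk⟩⟩
  · rintro ⟨S, hS⟩
    rw [SimpleGraph.isNIndepSet_iff] at hS
    rw [← hS.2]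
    exact hS.1.card_le_indepNum

theorem allNormal_inputMem {X : Finset Shape} (hX : X.card = 3) (hR : UsesShapes X R) :
    AllNormal (inputMem R k) := by
  have hsz := inputMem_size R k
  have hmiss : ∃ s, s ∉ X := by
    by_contra h
    push Not at h
    -- Shapes are named by the position of the corner, so `lowerLeft` is the shape going right and
    -- up, and so on.
    have hsub : ({.lowerLeft, .upperLeft, .upperRight, .lowerRight} : Finset Shape) ⊆ X :=
      fun s _ => h s
    have hcard := Finset.card_le_card hsub
    rw [hX] at hcard
    exact absurd hcard (by decide)
  obtain ⟨s, hs⟩ := hmiss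
  have hno : ∀ v, ¬ (R v).HasShape s := fun v h => hs (hR v s h)
  have key : ∀ u < (inputMem R k).size, ∃ v : Fin n, inputMem R k 0 u = (R v).cx ∧
      inputMem R k 1 u = (R v).cy ∧ inputMem R k 2 u = (R v).hx ∧
      inputMem R k 3 u = (R v).vy := fun u hu =>
    ⟨⟨u, hsz ▸ hu⟩, inputMem_coords R k ⟨u, hsz ▸ hu⟩⟩
  intro v hv
  refine normal_coords ?_ hv
  cases s
  · refine Or.inr (Or.inr (Or.inr ?_))
    rintro ⟨u, hu, h⟩
    obtain ⟨w, h0, h1, h2, h3⟩ := key u hu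
    rw [h0, h1, h2, h3] at h
    exact hno w h
  · refine Or.inr (Or.inr (Or.inl ?_))
    rintro ⟨u, hu, h⟩
    obtain ⟨w, h0, h1, h2, h3⟩ := key u hu
    rw [h0, h1, h2, h3] at h
    exact hno w h
  · refine Or.inl ?_
    rintro ⟨u, hu, h⟩
    obtain ⟨w, h0, h1, h2, h3⟩ := key u hu
    rw [h0, h1, h2, h3] at h
    exact hno w h
  · refine Or.inr (Or.inl ?_)
    rintro ⟨u, hu, h⟩
    obtain ⟨w, h0, h1, h2, h3⟩ := key u hu
    rw [h0, h1, h2, h3] at h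
    exact hno w h

end

/-! ## The two algorithms -/

theorem exec_setup {n : ℕ} (R : Fin n → GridPath) (k : ℕ) : ∃ τ,
    Exec (.seq (.store 4 (.const 0) (.reg 0)) (.store 4 (.const 1) (.reg 1))) (input R k) 6 τ ∧
      τ.arr = inputMem R k :=
  ⟨_, .seq (.store _ _ _ _) (.store _ _ _ _), rfl⟩

theorem Cmd.exec {F : Unit → Mem → Mem} (hF : Cmd F) : ∃ (T : Polynomial ℕ) (p : Program),
    ∀ σ : State, ∃ t τ, Exec p σ t τ ∧ t ≤ T.eval (Mem.size σ.arr) ∧ τ.arr = F () σ.arr := by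
  obtain ⟨-, T, hT⟩ := hF
  obtain ⟨p, hp⟩ := hT id 0 fun j hj => absurd hj (Nat.not_lt_zero j)
  refine ⟨T, p, fun σ => ?_⟩
  obtain ⟨t, τ, h1, h2, -, h3⟩ := hp () σ fun j hj => absurd hj (Nat.not_lt_zero j)
  exact ⟨t, τ, h1, h2, h3⟩

theorem Ev.exec {f : Unit → Mem → ℕ} (hf : Ev f) : ∃ (T : Polynomial ℕ) (p : Program),
    ∀ σ : State, ∃ t τ, Exec p σ t τ ∧ t ≤ T.eval (Mem.size σ.arr) ∧ τ.arr = σ.arr ∧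
      τ.reg 0 = f () σ.arr := by
  obtain ⟨T, hT⟩ := hf
  obtain ⟨p, hp⟩ := hT id 0 fun j hj => absurd hj (Nat.not_lt_zero j)
  refine ⟨T, p, fun σ => ?_⟩
  obtain ⟨t, τ, h1, h2, -, h3, h4⟩ := hp () σ fun j hj => absurd hj (Nat.not_lt_zero j)
  exact ⟨t, τ, h1, h2, h3, h4⟩

/-- Mark all vertices in array `a`. -/
def markAll (a : ℕ) (m : Mem) : Mem := iter (fun v m => m.set a v 1) m.size m

theorem markAll_spec (a : ℕ) (m : Mem) : (∀ c ≠ a, markAll a m c = m c) ∧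
    ∀ v < m.size, markAll a m a v = 1 :=
  iter_set (c := a) (val := fun _ _ => 1) (fun _ _ _ _ _ => rfl) m m.size

theorem Cmd.markAll {a : ℕ} (ha : a ≠ 4) : Cmd fun (_ : Unit) m => markAll a m :=
  .forLoop (F := fun _ v m => m.set a v 1) (.store a .var (.const 1) (Or.inl ha))

/-- Write the wanted size for the bottom frame of the stack. -/
def setGoal (m : Mem) : Mem := m.set 9 0 (m 4 1)

/-- Let the stack have one frame. -/
def setTop (m : Mem) : Mem := m.set 4 2 1

/-- Let the first free frame be the second one. -/
def setBase (m : Mem) : Mem := m.set 4 3 m.size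

/-- Start the search with a single frame that contains all vertices. -/
def initSearch (m : Mem) : Mem := setBase (setTop (setGoal (markAll 8 m)))

theorem Cmd.initSearch : Cmd fun (_ : Unit) m => initSearch m := by
  have h1 : Cmd fun (_ : Unit) m => setGoal m :=
    .store 9 (.const 0) (.arr 4 (.const 1)) (by simp)
  have h2 : Cmd fun (_ : Unit) m => setTop m := .store 4 (.const 2) (.const 1) (by simp)
  have h3 : Cmd fun (_ : Unit) m => setBase m := .store 4 (.const 3) .size (by simp)
  exact (((Cmd.markAll (by norm_num)).comp h1).comp h2).comp h3

theorem initSearch_apply (m : Mem) (a j : ℕ) : initSearch m a j =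
    if a = 4 ∧ j = 3 then m.size else if a = 4 ∧ j = 2 then 1 else if a = 9 ∧ j = 0 then m 4 1
    else markAll 8 m a j := by
  have h4 := (markAll_spec 8 m).1 4 (by norm_num)
  simp [initSearch, setBase, setTop, setGoal, Mem.set_apply, Mem.size, h4]

theorem searchInv_init {n : ℕ} (R : Fin n → GridPath) (k : ℕ) :
    SearchInv (inputMem R k) (∃ S, IsSol (NConf (inputMem R k)) (· < n) k S)
      (initSearch (inputMem R k)) ∧ potential (initSearch (inputMem R k)) = treeSize k := by
  have hsz := inputMem_size R k
  have hk := inputMem_goal R k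
  have hf := inputMem_flag R k
  generalize inputMem R k = m at *
  have h2 : initSearch m 4 2 = 1 := by simp [initSearch_apply]
  have h9 : initSearch m 9 0 = k := by simp [initSearch_apply, hk]
  have h4 : initSearch m 4 4 = 0 := by
    simp [initSearch_apply, (markAll_spec 8 m).1 4 (by norm_num), hf]
  have hsame : SameInput m (initSearch m) := by
    refine ⟨?_, fun a ha => ?_⟩
    · simp [Mem.size, initSearch_apply, (markAll_spec 8 m).1 4 (by norm_num)]
    · ext j
      rw [initSearch_apply, (markAll_spec 8 m).1 a (by omega)]
      have h1 : a ≠ 4 := by omega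
      have h2 : a ≠ 9 := by omega
      simp [h1, h2]
  refine ⟨⟨hsame, ?_, by omega, ?_⟩, by simp [potential, h2, h9]⟩
  · rw [hsame.size, h2]
    simp [initSearch_apply]
  · have hfr : Frame (initSearch m) 0 = (· < n) := by
      ext w
      unfold Frame
      rw [hsame.size, hsz]
      refine and_iff_left_of_imp fun hw => ?_
      simpa [initSearch_apply] using (markAll_spec 8 m).2 w (hsz.symm ▸ hw)
    constructor
    · rintro ⟨S, hS⟩
      exact Or.inr ⟨0, by omega, S, by rwa [hfr, h9]⟩
    · rintro (h | ⟨j, hj, S, hS⟩)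
      · omega
      · obtain rfl : j = 0 := by omega
        rw [hfr, h9] at hS
        exact ⟨S, hS⟩

theorem exists_decision_algorithm : ∃ (M : Program) (p : Polynomial ℕ),
    ∀ X : Finset Shape, X.card = 3 → ∀ (n k : ℕ) (R : Fin n → GridPath), UsesShapes X R →
      ∃ (t : ℕ) (τ : State), Exec M (input R k) t τ ∧ t ≤ k ^ (2 * k) * p.eval n ∧
        τ.Answers (k ≤ (graph R).indepNum) := by
  obtain ⟨T, p, hp⟩ := Cmd.initSearch.exec
  obtain ⟨U, q, hq⟩ := Cmd.searchStep.exec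
  obtain ⟨V, r, hr⟩ := (Ev.arr (E := Unit) 4 (.const 4)).exec
  -- The setup costs 6 and the failing loop test 4. Each of the at most `24 * k ^ (2 * k)` rounds
  -- costs 4 for the test and at most `U` for the step. The search runs until the stack is empty,
  -- even after a success.
  refine ⟨.seq (.seq (.store 4 (.const 0) (.reg 0)) (.store 4 (.const 1) (.reg 1)))
    (.seq p (.seq (.whileLt (.const 0) (.arr 4 (.const 2)) q) r)), 10 + T + V + 24 * (4 + U),
    fun X hX n k R hR => ?_⟩
  have hm := allNormal_inputMem R k hX hR
  have hsz := inputMem_size R k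
  obtain ⟨σ₁, e1, a1⟩ := exec_setup R k
  obtain ⟨t₂, σ₂, e2, b2, a2⟩ := hp σ₁
  rw [a1, hsz] at b2
  rw [a1] at a2
  obtain ⟨hinv, hpot⟩ := searchInv_init R k
  obtain ⟨t₃, σ₃, e3, b3, i3, c3⟩ := exec_while (e₁ := .const 0) (e₂ := .arr 4 (.const 2))
    (body := q) (C := U.eval n) (fun σ => SearchInv (inputMem R k)
      (∃ S, IsSol (NConf (inputMem R k)) (· < n) k S) σ.arr) (fun σ => potential σ.arr) (by
      intro σ hσ hc
      obtain ⟨t, τ, h1, h2, h3⟩ := hq σ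
      rw [hσ.same.size, hsz] at h2
      have := hσ.step hm hc
      rw [← h3] at this
      exact ⟨t, τ, h1, h2, this⟩) σ₂ (by rw [a2]; exact hinv)
  obtain ⟨t₄, σ₄, e4, b4, a4, r4⟩ := hr σ₃
  rw [i3.same.size, hsz] at b4
  refine ⟨_, σ₄, .seq e1 (.seq e2 (.seq e3 e4)), ?_, ?_⟩
  · rw [a2, hpot] at b3
    simp only [Expr.cost] at b3
    -- The costs outside the loop also have to fit under the factor `k ^ (2 * k)`; for `k = 0` this
    -- uses `0 ^ 0 = 1`.
    have hpos : 1 ≤ k ^ (2 * k) := by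
      rcases Nat.eq_zero_or_pos k with rfl | hk
      · simp
      · exact Nat.one_le_pow _ _ hk
    have h1 := Nat.mul_le_mul_right (1 + (1 + 1) + 1 + U.eval n) (treeSize_le_pow k)
    have h2 := Nat.mul_le_mul_right (10 + T.eval n + V.eval n) hpos
    simp only [Polynomial.eval_add, Polynomial.eval_mul, Polynomial.eval_ofNat]
    have h3 : k ^ (2 * k) * (10 + T.eval n + V.eval n + 24 * (4 + U.eval n)) =
      k ^ (2 * k) * (10 + T.eval n + V.eval n) +
        24 * k ^ (2 * k) * (1 + (1 + 1) + 1 + U.eval n) := by ring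
    omega
  · have hs0 : σ₃.arr 4 2 = 0 := by
      simp only [Expr.eval] at c3
      omega
    have hiff := i3.iff
    rw [hs0, exists_isSol_iff, ← le_indepNum_iff] at hiff
    have hflag := i3.flag
    unfold State.Answers
    rw [r4, hiff]
    rcases Nat.le_one_iff_eq_zero_or_eq_one.1 hflag with h | h
    · right; simp [h]
    · left; simp [h]

/-- The first vertex marked in array `7`. -/
noncomputable def firstMarked (m : Mem) : ℕ :=
  open Classical in ∑ u ∈ Finset.range m.size,
    if m 7 u = 1 ∧ ¬ ∃ w < m.size, w < u ∧ m 7 w = 1 then u else 0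

theorem firstMarked_spec {m : Mem} (h : ∃ u < m.size, m 7 u = 1) :
    firstMarked m < m.size ∧ m 7 (firstMarked m) = 1 := by
  classical
  have hu := Nat.find_spec h
  have hmin : ∀ w, w < Nat.find h → ¬ (w < m.size ∧ m 7 w = 1) := fun w hw => Nat.find_min h hw
  generalize Nat.find h = u at *
  have : firstMarked m = u := by
    unfold firstMarked
    rw [Finset.sum_eq_single u]
    · rw [if_pos]
      exact ⟨hu.2, fun ⟨w, hw, hlt, hw'⟩ => hmin w hlt ⟨hw, hw'⟩⟩
    · intro w hw hne
      rw [if_neg]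
      rintro ⟨h1, h2⟩
      rcases lt_or_gt_of_ne hne with hlt | hlt
      · exact hmin w hlt ⟨Finset.mem_range.1 hw, h1⟩
      · exact h2 ⟨u, hu.1, hlt, hu.2⟩
    · intro h'
      exact absurd (Finset.mem_range.2 hu.1) h'
  rw [this]
  exact hu

/-- Write a list of the vertices marked in array `7` to array `0`. -/
noncomputable def writeList (m : Mem) : Mem :=
  iter (fun v m => m.set 0 v (if m 7 v = 1 then v else firstMarked m)) m.size m

/-- The list has one entry per vertex; the entries of unmarked vertices are padded with the first
marked vertex, so no compaction is needed. Overwriting array `0` is harmless, since the values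
written depend only on arrays `4` and `7`. -/
theorem writeList_spec (m : Mem) : (∀ a ≠ 0, writeList m a = m a) ∧
    ∀ v < m.size, writeList m 0 v = if m 7 v = 1 then v else firstMarked m := by
  have hcongr : ∀ m m' : Mem, (∀ a ≠ 0, m' a = m a) → firstMarked m' = firstMarked m := by
    intro m m' h
    unfold firstMarked Mem.size
    rw [h 4 (by norm_num)]
    refine Finset.sum_congr rfl fun u _ => if_congr ?_ rfl rfl
    rw [h 7 (by norm_num)]
  have h := iter_set (c := 0) (val := fun v m => if m 7 v = 1 then v else firstMarked m) (by
    intro i m m' h _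
    simp only [h 7 (by norm_num), hcongr m m' h]) m m.size
  change (∀ a ≠ 0, writeList m a = m a) ∧ ∀ v < m.size, writeList m 0 v =
    if writeList m 7 v = 1 then v else firstMarked (writeList m) at h
  refine ⟨h.1, fun v hv => ?_⟩
  rw [h.2 v hv, h.1 7 (by norm_num), hcongr _ _ h.1]

theorem Cmd.writeList : Cmd fun (_ : Unit) m => writeList m :=
  .forLoop (F := fun _ v m => m.set 0 v (if m 7 v = 1 then v else firstMarked m))
    (.store 0 .var (.ite (.eq (.arr 7 .var) (.const 1)) .var
      (.sum (f := fun _ u m => open Classical in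
        if m 7 u = 1 ∧ ¬ ∃ w < m.size, w < u ∧ m 7 w = 1 then u else 0)
        (.ite (.and (.eq (.arr 7 .var) (.const 1)) (.not (.ex
          (P := fun (e : (Unit × ℕ) × ℕ) w m => w < e.2 ∧ m 7 w = 1)
          (.and (.lt .var (.weak .var)) (.eq (.arr 7 .var) (.const 1))))))
          .var (.const 0)))) (by simp))

theorem exists_selection_algorithm : ∃ (M : Program) (p : Polynomial ℕ),
    ∀ X : Finset Shape, X.card = 3 → ∀ (n k : ℕ) (R : Fin n → GridPath), 1 ≤ k →
      UsesShapes X R → ∃ (t : ℕ) (τ : State) (X' : Finset (Fin n)),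
        Exec M (input R k) t τ ∧ t ≤ p.eval n ∧ τ.Outputs X' ∧ X'.card ≤ 17 * k ^ 2 ∧
        ((∃ S : Finset (Fin n), (graph R).IsNIndepSet k S) →
          ∃ S : Finset (Fin n), (graph R).IsNIndepSet k S ∧ (S ∩ X').Nonempty) := by
  obtain ⟨T, p, hp⟩ := (((Cmd.markAll (a := 5) (by norm_num)).comp .select).comp .writeList).exec
  -- If nothing is marked there is no vertex to pad with, and the length of the list has to be zero.
  obtain ⟨V, r, hr⟩ := (show Ev (E := Unit) fun _ m => open Classical in
      if ∃ u < m.size, m 7 u = 1 then m.size else 0 from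
    .ite (.ex (P := fun _ u m => m 7 u = 1) (.eq (.arr 7 .var) (.const 1))) .size (.const 0)).exec
  refine ⟨.seq (.seq (.store 4 (.const 0) (.reg 0)) (.store 4 (.const 1) (.reg 1))) (.seq p r),
    6 + T + V, fun X hX n k R hk hR => ?_⟩
  have hm := allNormal_inputMem R k hX hR
  have hsz := inputMem_size R k
  have hgoal := inputMem_goal R k
  obtain ⟨σ₁, e1, a1⟩ := exec_setup R k
  obtain ⟨t₂, σ₂, e2, b2, a2⟩ := hp σ₁
  rw [a1, hsz] at b2
  rw [a1] at a2
  obtain ⟨t₃, σ₃, e3, b3, a3, r3⟩ := hr σ₂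
  have hall := markAll_spec 5 (inputMem R k)
  have hsame₁ : SameInput (inputMem R k) (markAll 5 (inputMem R k)) :=
    sameInput_of_arr fun a ha => hall.1 a (by omega)
  have hk₁ : markAll 5 (inputMem R k) 4 1 = k := by rw [hall.1 4 (by norm_num), hgoal]
  have hmark : Marked 5 (markAll 5 (inputMem R k)) = (· < n) := by
    ext v
    unfold Marked
    rw [hsame₁.size, hsz]
    exact and_iff_left_of_imp fun hv => hall.2 v (hsz.symm ▸ hv)
  have hTS : AllNormal (markAll 5 (inputMem R k)) := by
    unfold AllNormal
    rw [hsame₁.size, hsame₁.coords.1, hsame₁.coords.2.1, hsame₁.coords.2.2.1, hsame₁.coords.2.2.2]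
    exact hm
  have hcard := select_card (markAll 5 (inputMem R k))
  have hex := @select_exists (markAll 5 (inputMem R k)) hTS
  have hsame₂ := select_sameInput (markAll 5 (inputMem R k))
  rw [hk₁, hmark, hsame₁.nconf, hsame₁.size, hsz] at hex
  rw [hk₁, hsame₁.size, hsz] at hcard
  have hsize := hsame₂.size
  rw [hsame₁.size, hsz] at hsize
  generalize select (markAll 5 (inputMem R k)) = m at *
  obtain ⟨w1, w2⟩ := writeList_spec m
  rw [← a2] at w1 w2
  rw [hsize] at w2
  have hsz₂ : Mem.size σ₂.arr = n := by
    rw [← hsize]; unfold Mem.size; rw [w1 4 (by norm_num)]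
  rw [hsz₂] at b3
  rw [hsz₂, w1 7 (by norm_num)] at r3
  have hfirst := firstMarked_spec (m := m)
  rw [hsize] at hfirst
  let X' : Finset (Fin n) := Finset.univ.filter fun v => m 7 v = 1
  refine ⟨_, σ₃, X', .seq e1 (.seq e2 e3), ?_, ?_, ?_, ?_⟩
  · simp only [Polynomial.eval_add, Polynomial.eval_ofNat]
    omega
  · unfold State.Outputs
    rw [r3, a3]
    by_cases h : ∃ u < n, m 7 u = 1
    · rw [if_pos h]
      ext v
      simp only [X', Finset.mem_image, Finset.mem_filter, Finset.mem_univ, true_and,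
        Finset.mem_range]
      constructor
      · rintro ⟨u, hu, rfl⟩
        exact ⟨u, u.2, by rw [w2 u u.2, if_pos hu]⟩
      · rintro ⟨u, hu, rfl⟩
        rw [w2 u hu]
        split_ifs with h7
        · exact ⟨⟨u, hu⟩, h7, rfl⟩
        · exact ⟨⟨_, (hfirst h).1⟩, (hfirst h).2, rfl⟩
    · rw [if_neg h, Finset.range_zero, Finset.image_empty, Finset.image_eq_empty,
        Finset.filter_eq_empty_iff]
      exact fun v _ hv => h ⟨v, v.2, hv⟩
  · have hle : X'.card ≤ 6 * k ^ 2 := by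
      rw [← Finset.card_map Fin.valEmbedding]
      refine le_trans (Finset.card_le_card ?_) hcard
      intro v hv
      obtain ⟨u, hu, rfl⟩ := Finset.mem_map.1 hv
      simp only [X', Finset.mem_filter, Finset.mem_univ, true_and] at hu
      simpa using hu
    omega
  · intro hS
    obtain ⟨S, hS⟩ := (exists_isSol_iff R k).2 hS
    obtain ⟨v, hv, hv7, S', hS', hvS⟩ := hex hk hS
    obtain ⟨S', rfl⟩ := exists_map_of_lt hS'.1
    refine ⟨S', (isSol_map_iff R k S').1 hS', ⟨v, hv⟩, ?_⟩
    rw [Finset.mem_inter]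
    refine ⟨?_, by simpa [X'] using hv7⟩
    obtain ⟨u, hu, huv⟩ := Finset.mem_map.1 hvS
    have : u = ⟨v, hv⟩ := Fin.ext huv
    rwa [← this]

end EPG

theorem theorem3 :
    (∃ (M : EPG.Program) (p : Polynomial ℕ),
      ∀ (X : Finset EPG.Shape), X.card = 3 →
      ∀ (n k : ℕ) (R : Fin n → EPG.GridPath), EPG.UsesShapes X R →
        ∃ (t : ℕ) (τ : EPG.State),
          EPG.Exec M (EPG.input R k) t τ ∧
          t ≤ k ^ (2 * k) * p.eval n ∧
          τ.Answers (k ≤ (EPG.graph R).indepNum)) ∧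
    (∃ (M : EPG.Program) (p : Polynomial ℕ),
      ∀ (X : Finset EPG.Shape), X.card = 3 →
      ∀ (n k : ℕ) (R : Fin n → EPG.GridPath), 1 ≤ k → EPG.UsesShapes X R →
        ∃ (t : ℕ) (τ : EPG.State) (X' : Finset (Fin n)),
          EPG.Exec M (EPG.input R k) t τ ∧
          t ≤ p.eval n ∧
          τ.Outputs X' ∧
          X'.card ≤ 17 * k ^ 2 ∧
          ((∃ S : Finset (Fin n), (EPG.graph R).IsNIndepSet k S) →
            ∃ S : Finset (Fin n), (EPG.graph R).IsNIndepSet k S ∧ (S ∩ X').Nonempty)) :=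
  ⟨EPG.exists_decision_algorithm, EPG.exists_selection_algorithm⟩
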